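/- **Setting.** For a metric space $X$ write $\langle x,z\rangle_y=\tfrac12\big(d(x,y)+d(y,z)-d(x,z)\big)$. A sequence $(x_n)$ is a Gromov sequence if $\langle x_n,x_m\rangle_{o}\to\infty$ as $n,m\to\infty$; two Gromov sequences are equivalent if $\langle x_n,y_n\rangle_{o}\to\infty$ (the choice of $o\in X$ is irrelevant); $\partial X$ is the set of classes and $\mathrm{Bord}\,X=X\cup\partial X$. The product is extended by $\langle \xi,\eta\rangle_z=\inf\liminf_{n,m}\langle x_n,y_m\rangle_z\in[0,\infty]$, the infimum being over $(x_n)\in\xi$, $(y_m)\in\eta$, and similarly $\langle x,\eta\rangle_z=\langle\eta,x\rangle_z=\inf_{(x_n)\in\eta}\liminf_n\langle x_n,x\rangle_z$ for $x\in X$. Let $b>1$, and suppose that $X$ is a separable geodesic metric space that is strongly hyperbolic with parameter $b$: for every $x\in X$ the function $\rho_{x,b}(\xi,\eta)=b^{-\langle\xi,\eta\rangle_x}$ (with $b^{-\infty}=0$) satisfies the triangle inequality on $\mathrm{Bord}\,X$. Fix $x_0\in X$ and put $\overline D_b=\rho_{x_0,b}$ and $D_b=\min\{(\log b)\,d,\overline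 D_b\}$ on $\mathrm{Bord}\,X$, where $d(\xi,\eta)=\infty$ if $\xi\ne\eta$ and one of them lies in $\partial X$. Let $G$ be the isometry group of $X$, acting on $\mathrm{Bord}\,X$, with the metric $$d_G(g_1,g_2)=\max\Big\{\sup_{\xi\in \mathrm{Bord}\,X}D_b(g_1\xi,g_2\xi),\ \sup_{\xi\in \mathrm{Bord}\,X}D_b(g_1^{-1}\xi,g_2^{-1}\xi)\Big\}.$$ Let $T$ be an ergodic measure-preserving transformation of a probability space $(\Omega,\mu)$. Let $S(\Omega,G)$ be the set of maps $g:\Omega\to G$ such that $g$ and $\omega\mapsto g(\omega)^{-1}$ are Borel measurable and $\sup_{\omega}b^{d(g(\omega)x_0,x_0)}<\infty$, with the pseudodistance $d_\infty(g_1,g_2)=\operatorname{ess\,sup}_{\omega}d_G(g_1(\omega),g_2(\omega))$. Cocycles may be identified when their $d_\infty$-distance is $0$; if they are not, the word distance below means pseudodistance. Put $g^{(n)}(\omega)=g(\omega)g(T\omega)\cdots g(T^{n-1}\omega)$, $\ell_n(g)=\frac1n\int_\Omega d(g^{(n)}(\omega)x_0,x_0)\,d\mu(\omega)$ and $\ell(g)=\lim_{n\to\infty}\ell_n(g)$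 (the drift; the limit exists by subadditivity). Let $\mathcal C$ be a class of such cocycles with a distance $d_{\mathcal C}\ge d_\infty$, and let $\mathcal C_+=\{g\in\mathcal C:\ell(g)>0\}$, with the same distance. Say that $g\in\mathcal C$ satisfies a uniform large deviation estimate if there are $r>0$ and $c>0$ such that for every $\varepsilon>0$ there is $\overline n$ with $$\mu\Big\{\omega:\Big|\tfrac1n d(g_1^{(n)}(\omega)x_0,x_0)-\ell_n(g_1)\Big|>\varepsilon\Big\}<b^{-c\varepsilon^2n}$$ for all $g_1\in\mathcal C$ with $d_{\mathcal C}(g,g_1)<r$ and all $n\ge\overline n$. Let $S^1(\Omega,\partial X)$ be the space of Borel measurable maps $\Omega\to\partial X$ (with respect to $\overline D_b$) with the distance $d_1(f_1,f_2)=\int_\Omega\overline D_b(f_1(\omega),f_2(\omega))\,d\mu(\omega)$. A map $f$ between spaces with distances is locally Hölder continuous if every point of the domain has a ball around it on which $\mathrm{dist}(f(a_1),f(a_2))\le K\,\mathrm{dist}(a_1,a_2)^\alpha$ for some $K$ and some $\alpha\in(0,1]$. **Theorem (Abstract Continuity Theorem).** Suppose that every $g\in\mathcal C_+$ satisfies a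 uniform large deviation estimate. Then: 1. the drift $\ell:\mathcal C\to\mathbb R$ is continuous; 2. the drift $\ell:\mathcal C_+\to\mathbb R$ is locally Hölder continuous; 3. for every $g\in\mathcal C_+$, for almost every $\omega$ the sequence $(g^{(n)}(\omega)x_0)_n$ is a Gromov sequence; its class, the hitting point $\xi_g(\omega)\in\partial X$, defines (up to a null set) an element $\xi_g$ of $S^1(\Omega,\partial X)$; and the map $\xi:\mathcal C_+\to S^1(\Omega,\partial X)$, $g\mapsto\xi_g$, is locally Hölder continuous. -/

import Mathlib

open MeasureTheory Filter Topology Set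

noncomputable section

namespace StrongHyp

/-! ### Geometry: Gromov boundary, visual metrics, strong hyperbolicity -/

section Geometry

variable {X : Type*} [MetricSpace X]

/-- The Gromov product `⟨x, z⟩_y` (it is always nonnegative). -/
def gromovProd (x z y : X) : ℝ := (dist x y + dist y z - dist x z) / 2

/-- `X` is geodesic: any two points are joined by an isometric embedding of `[0, d(x,y)]`. -/
def IsGeodesic (X : Type*) [MetricSpace X] : Prop :=
  ∀ x y : X, ∃ γ : ℝ → X, γ 0 = x ∧ γ (dist x y) = y ∧
    ∀ s ∈ Icc 0 (dist x y), ∀ t ∈ Icc 0 (dist x y), dist (γ s) (γ t) = |s - t|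

/-- Gromov sequences: `⟨x_n, x_m⟩_o → ∞` as `n, m → ∞`. Changing the basepoint `o` changes the
Gromov product by a bounded amount, so quantifying over all `o` is the same as fixing one. -/
def IsGromovSeq (u : ℕ → X) : Prop :=
  ∀ o : X, Tendsto (fun p : ℕ × ℕ => gromovProd (u p.1) (u p.2) o) atTop atTop

/-- The type of Gromov sequences of `X`. -/
def GromovSeq (X : Type*) [MetricSpace X] : Type _ := {u : ℕ → X // IsGromovSeq u}

/-- Two Gromov sequences are equivalent if `⟨x_n, y_n⟩_o → ∞`. -/
def GromovEquiv (u v : GromovSeq X) : Prop :=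
  ∀ o : X, Tendsto (fun n : ℕ => gromovProd (u.1 n) (v.1 n) o) atTop atTop

/-- The Gromov boundary `∂X`: Gromov sequences modulo equivalence. (In a hyperbolic space
`GromovEquiv` is an equivalence relation, so `Quot` is the usual set of classes.) -/
def GromovBoundary (X : Type*) [MetricSpace X] : Type _ :=
  Quot (GromovEquiv (X := X))

/-- The boundary point represented by a Gromov sequence. -/
def GromovBoundary.mk (u : GromovSeq X) : GromovBoundary X := Quot.mk _ u

/-- `Bord X = X ∪ ∂X`. -/
abbrev Bord (X : Type*) [MetricSpace X] : Type _ := X ⊕ GromovBoundary X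

/-- The Gromov product `⟨ξ, η⟩_z` extended to `Bord X`, with values in `[0, ∞]`. -/
def gromovProdBord (z : X) : Bord X → Bord X → ENNReal
  | .inl x, .inl y => ENNReal.ofReal (gromovProd x y z)
  | .inl x, .inr η => ⨅ (v : GromovSeq X) (_ : GromovBoundary.mk v = η),
      liminf (fun n : ℕ => ENNReal.ofReal (gromovProd (v.1 n) x z)) atTop
  | .inr ξ, .inl y => ⨅ (u : GromovSeq X) (_ : GromovBoundary.mk u = ξ),
      liminf (fun n : ℕ => ENNReal.ofReal (gromovProd (u.1 n) y z)) atTop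
  | .inr ξ, .inr η => ⨅ (u : GromovSeq X) (_ : GromovBoundary.mk u = ξ)
      (v : GromovSeq X) (_ : GromovBoundary.mk v = η),
      liminf (fun p : ℕ × ℕ => ENNReal.ofReal (gromovProd (u.1 p.1) (v.1 p.2) z)) atTop

/-- `b ^ (-t)` for `t ∈ [0, ∞]`, with `b ^ (-∞) = 0`. -/
def negPow (b : ℝ) (t : ENNReal) : ℝ := if t = ⊤ then 0 else b ^ (-t.toReal)

/-- `ρ_{x,b}(ξ, η) = b ^ (-⟨ξ, η⟩_x)` on `Bord X`. For a basepoint `x₀` this is `D̄_b`. -/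
def rho (b : ℝ) (x : X) (ξ η : Bord X) : ℝ := negPow b (gromovProdBord x ξ η)

/-- `X` is strongly hyperbolic with parameter `b > 1`: every `ρ_{x,b}` satisfies the triangle
inequality on `Bord X`. (Then `X` is Gromov `δ`-hyperbolic with `δ = log_b 2`.) -/
structure StronglyHyperbolic (X : Type*) [MetricSpace X] (b : ℝ) : Prop where
  one_lt : 1 < b
  triangle : ∀ (x : X) (ξ η ζ : Bord X), rho b x ξ ζ ≤ rho b x ξ η + rho b x η ζ

/-- The visual metric `D_b = min {(log b) d, D̄_b}` on `Bord X`, where `d = ∞` as soon as one of two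
distinct points lies in `∂X`. (For a point of `∂X` paired with itself, `D̄_b` is `0`.) -/
def visualDist (b : ℝ) (x₀ : X) : Bord X → Bord X → ℝ
  | .inl x, .inl y => min (Real.log b * dist x y) (rho b x₀ (.inl x) (.inl y))
  | .inl x, .inr η => rho b x₀ (.inl x) (.inr η)
  | .inr ξ, .inl y => rho b x₀ (.inr ξ) (.inl y)
  | .inr ξ, .inr η => rho b x₀ (.inr ξ) (.inr η)

lemma gromovProd_map (g : X ≃ᵢ X) (x y o : X) :
    gromovProd (g x) (g y) o = gromovProd x y (g.symm o) := by
  have h1 : dist (g x) o = dist x (g.symm o) := by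
    rw [← g.dist_eq x (g.symm o), g.apply_symm_apply]
  have h2 : dist o (g y) = dist (g.symm o) y := by
    rw [← g.dist_eq (g.symm o) y, g.apply_symm_apply]
  simp only [gromovProd, h1, h2, g.dist_eq]

/-- The image of a Gromov sequence under an isometry. -/
def GromovSeq.map (g : X ≃ᵢ X) (u : GromovSeq X) : GromovSeq X :=
  ⟨fun n => g (u.1 n), fun o => by simpa only [gromovProd_map] using u.2 (g.symm o)⟩

/-- The action of isometries on `∂X`, `g [x_n] = [g x_n]`. -/
def GromovBoundary.map (g : X ≃ᵢ X) : GromovBoundary X → GromovBoundary X :=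
  Quot.map (GromovSeq.map g) fun u v h o => by
    simpa only [GromovSeq.map, gromovProd_map] using h (g.symm o)

/-- The action of isometries on `Bord X`. -/
def bordMap (g : X ≃ᵢ X) : Bord X → Bord X := Sum.map g (GromovBoundary.map g)

/-- The distance `d_G` on the isometry group `G = (X ≃ᵢ X)`. Both suprema are over values in
`[0, 1]` when `1 < b`. -/
def dG (b : ℝ) (x₀ : X) (g₁ g₂ : X ≃ᵢ X) : ℝ :=
  max (⨆ ξ : Bord X, visualDist b x₀ (bordMap g₁ ξ) (bordMap g₂ ξ))
    (⨆ ξ : Bord X, visualDist b x₀ (bordMap g₁⁻¹ ξ) (bordMap g₂⁻¹ ξ))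

end Geometry

/-- The topology of a distance function `d`: `U` is open iff it contains a `d`-ball around each of
its points. -/
@[reducible] def distTopology {A : Type*} (d : A → A → ℝ) : TopologicalSpace A where
  IsOpen U := ∀ a ∈ U, ∃ r > 0, ∀ a', d a a' < r → a' ∈ U
  isOpen_univ := fun _ _ => ⟨1, one_pos, fun _ _ => mem_univ _⟩
  isOpen_inter := fun U V hU hV a ha => by
    obtain ⟨r, hr, h⟩ := hU a ha.1
    obtain ⟨s, hs, k⟩ := hV a ha.2
    exact ⟨min r s, lt_min hr hs, fun a' h' =>
      ⟨h a' (h'.trans_le (min_le_left _ _)), k a' (h'.trans_le (min_le_right _ _))⟩⟩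
  isOpen_sUnion := fun S hS a ha => by
    obtain ⟨U, hU, haU⟩ := ha
    obtain ⟨r, hr, h⟩ := hS U hU a haU
    exact ⟨r, hr, fun a' h' => ⟨U, hU, h a' h'⟩⟩

/-- The Borel σ-algebra of a distance function. -/
@[reducible] def distBorel {A : Type*} (d : A → A → ℝ) : MeasurableSpace A := @borel A (distTopology d)

/-! ### Cocycles, drift, hitting points -/

section Dynamics

variable {X : Type*} [MetricSpace X] {Ω : Type*} [MeasurableSpace Ω]

/-- The space `S(Ω, G)`: maps `g : Ω → G` such that `g` and `g⁻¹` are Borel measurable for the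
metric `d_G` and `sup_ω b ^ d(g(ω) x₀, x₀) < ∞`. Elements at `dInfty`-distance `0` are not
identified here; distances between cocycles are therefore pseudodistances. -/
structure BddCocycle (Ω : Type*) [MeasurableSpace Ω] (b : ℝ) (x₀ : X) where
  toFun : Ω → (X ≃ᵢ X)
  measurable : @Measurable Ω (X ≃ᵢ X) _ (distBorel (dG b x₀)) toFun
  measurable_inv : @Measurable Ω (X ≃ᵢ X) _ (distBorel (dG b x₀)) (fun ω => (toFun ω)⁻¹)
  bounded : BddAbove (range fun ω => b ^ dist (toFun ω x₀) x₀)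

/-- The (pseudo)distance `d_∞(g₁, g₂) = ess sup_ω d_G(g₁(ω), g₂(ω))`. -/
def dInfty {b : ℝ} {x₀ : X} (μ : Measure Ω) (g₁ g₂ : BddCocycle Ω b x₀) : ℝ :=
  essSup (fun ω => dG b x₀ (g₁.toFun ω) (g₂.toFun ω)) μ

/-- `g^{(n)}(ω) = g(ω) g(Tω) ⋯ g(T^{n-1}ω)`. -/
def iter (T : Ω → Ω) (g : Ω → (X ≃ᵢ X)) : ℕ → Ω → (X ≃ᵢ X)
  | 0, _ => 1
  | n + 1, ω => iter T g n ω * g (T^[n] ω)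

variable {b : ℝ} {x₀ : X}

/-- The finite scale drift `ℓ_n(g) = (1/n) ∫ d(g^{(n)}(ω) x₀, x₀) dμ(ω)`. -/
def finDrift (T : Ω → Ω) (μ : Measure Ω) (g : BddCocycle Ω b x₀) (n : ℕ) : ℝ :=
  (1 / (n : ℝ)) * ∫ ω, dist (iter T g.toFun n ω x₀) x₀ ∂μ

/-- The drift `ℓ(g) = lim_n ℓ_n(g)`. The limit exists by subadditivity of `n ↦ n ℓ_n(g)` when `T`
preserves the finite measure `μ`, `X` is separable and strongly hyperbolic with parameter `b`. -/
def drift (T : Ω → Ω) (μ : Measure Ω) (g : BddCocycle Ω b x₀) : ℝ :=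
  limUnder atTop (finDrift T μ g)

/-- Uniform large deviation estimates of exponential type for `g` within the class `C`, where
`C` carries the distance `dist`. -/
def UniformLDE (T : Ω → Ω) (μ : Measure Ω) (C : Set (BddCocycle Ω b x₀)) [PseudoMetricSpace C]
    (g : C) : Prop :=
  ∃ r > 0, ∃ c > 0, ∀ ε > 0, ∃ n₀ : ℕ, ∀ g₁ : C, dist g g₁ < r → ∀ n ≥ n₀,
    μ.real {ω | ε < |1 / (n : ℝ) * dist (iter T g₁.1.toFun n ω x₀) x₀ - finDrift T μ g₁.1 n|}
      < b ^ (-(c * ε ^ 2 * (n : ℝ)))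

/-- The space `S¹(Ω, ∂X)` of maps `Ω → ∂X` that are Borel measurable for the metric `D̄_b` on `∂X`
(this metric is bounded by `1`, so all maps are bounded). -/
structure BoundaryMap (Ω : Type*) [MeasurableSpace Ω] (b : ℝ) (x₀ : X) where
  toFun : Ω → GromovBoundary X
  measurable : @Measurable Ω (GromovBoundary X) _
    (distBorel fun ξ η => rho b x₀ (.inr ξ) (.inr η)) toFun

/-- The distance `d₁(f₁, f₂) = ∫ D̄_b(f₁(ω), f₂(ω)) dμ(ω)` on `S¹(Ω, ∂X)`. -/
def d1 (μ : Measure Ω) (f₁ f₂ : BoundaryMap Ω b x₀) : ℝ :=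
  ∫ ω, rho b x₀ (.inr (f₁.toFun ω)) (.inr (f₂.toFun ω)) ∂μ

/-- `ξ ∈ ∂X` is the hitting point of the path `(g^{(n)}(ω) x₀)_n`: the path is a Gromov sequence
and represents `ξ`, i.e. it converges to `ξ` in `Bord X`. -/
def IsHittingPoint (T : Ω → Ω) (g : BddCocycle Ω b x₀) (ω : Ω) (ξ : GromovBoundary X) : Prop :=
  ∃ h : IsGromovSeq (fun n => iter T g.toFun n ω x₀), GromovBoundary.mk ⟨_, h⟩ = ξ

/-- The positive-drift part `C_+`, with the distance of `C`. -/
abbrev PosDrift (T : Ω → Ω) (μ : Measure Ω) (C : Set (BddCocycle Ω b x₀)) : Type _ :=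
  {g : C // 0 < drift T μ g.1}

end Dynamics

/-- Local Hölder continuity of a map into a set with distance function `dB`: near each point it is
Hölder, with exponent and constant depending on the point. -/
def LocallyHolder {A B : Type*} [PseudoMetricSpace A] (dB : B → B → ℝ) (f : A → B) : Prop :=
  ∀ a : A, ∃ r > 0, ∃ α : ℝ, 0 < α ∧ α ≤ 1 ∧ ∃ K : ℝ, ∀ a₁ ∈ Metric.ball a r,
    ∀ a₂ ∈ Metric.ball a r, dB (f a₁) (f a₂) ≤ K * dist a₁ a₂ ^ α

end StrongHyp

end

open StrongHyp

namespace StrongHyp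

/-! ### Gromov products, the visual kernel and horofunctions. -/

section Geometry

variable {X : Type*} [MetricSpace X]

/-! Write a_n for the mean displacement ∫ d(g^(n) x₀, x₀) dμ. Strong hyperbolicity yields a
Ptolemaic inequality, and with it horofunctions y ↦ d(o, y) - d(p, y) that are Lipschitz for the
visual kernel b^(-⟨y,z⟩_o) (`abs_busemann_sub_le`). Since T preserves μ, the second difference of
a_n is an integral of such horofunction differences between consecutive orbit points
(`abs_displacement_second_difference_le`), hence at most a constant times ∫ b^(-d(g^(n+1) x₀, x₀))
dμ. A large deviation estimate and linear growth of a_n make this integral exponentially small, so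
the increments a_(n+1) - a_n converge to the drift at a geometric rate.

The rate is uniform near g. Growth makes increments stable and stable increments preserve growth, so
an estimate at one scale N, which passes to nearby cocycles by continuity of a_N and a_(N+1),
propagates to all n ≥ N (`linear_growth_of_increments`, `exists_uniform_decay`).

Two cocycles at distance δ have close orbits up to time n once δ ≤ b^(-(M+1)n), where M bounds the
steps. Comparing at time n gives an error of order b^(-κn), and choosing n of order log(1/δ) turns
it into a Hölder bound (`holder_of_geometric`). For the drift, compare increments; for hitting
points, pass through the orbit points at time n, whose visual distance to the limit is at most twice
the sum of the remaining kernels. At zero drift, continuity follows from nonnegativity and Fekete's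
infimum, which gives upper semicontinuity. -/

lemma gromovProd_nonneg (x y o : X) : 0 ≤ gromovProd x y o := by
  unfold gromovProd
  linarith [dist_triangle x o y]

lemma gromovProd_comm (x y o : X) : gromovProd x y o = gromovProd y x o := by
  unfold gromovProd
  rw [dist_comm x o, dist_comm o y, dist_comm x y]
  ring

lemma gromovProd_le_dist_left (x y o : X) : gromovProd x y o ≤ dist x o := by
  unfold gromovProd
  linarith [dist_triangle o x y, dist_comm o x]

lemma dist_sub_le_gromovProd (x y o : X) : dist x o - dist x y ≤ gromovProd x y o := by
  unfold gromovProd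
  linarith [dist_triangle x y o, dist_comm o y]

lemma gromovProd_le_basepoint (x y o o' : X) :
    gromovProd x y o ≤ gromovProd x y o' + dist o o' := by
  unfold gromovProd
  linarith [dist_triangle x o' o, dist_comm o o', dist_triangle o o' y]

lemma gromovProd_le_add_dist (u x y o : X) :
    gromovProd u x o ≤ gromovProd u y o + dist x y := by
  unfold gromovProd
  linarith [dist_triangle o y x, dist_comm x y, dist_triangle u x y]

/-- The visual kernel `b ^ (-⟨x, y⟩_o)` on points of `X`. -/
noncomputable def visKernel (b : ℝ) (o x y : X) : ℝ := b ^ (-gromovProd x y o)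

lemma rho_inl_inl (b : ℝ) (o x y : X) : rho b o (.inl x) (.inl y) = visKernel b o x y := by
  simp [rho, negPow, gromovProdBord, visKernel, ENNReal.toReal_ofReal (gromovProd_nonneg x y o)]

lemma rho_inl_inr_comm (b : ℝ) (o x : X) (ξ : GromovBoundary X) :
    rho b o (.inl x) (.inr ξ) = rho b o (.inr ξ) (.inl x) := rfl

lemma visKernel_comm (b : ℝ) (o x y : X) : visKernel b o x y = visKernel b o y x := by
  rw [visKernel, gromovProd_comm, visKernel]

lemma negPow_nonneg {b : ℝ} (hb : 1 < b) (t : ENNReal) : 0 ≤ negPow b t := by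
  unfold negPow
  split_ifs
  · exact le_rfl
  · positivity

lemma negPow_le_one {b : ℝ} (hb : 1 < b) (t : ENNReal) : negPow b t ≤ 1 := by
  unfold negPow
  split_ifs
  · exact zero_le_one
  · exact Real.rpow_le_one_of_one_le_of_nonpos hb.le (by simp)

lemma rho_nonneg {b : ℝ} (hb : 1 < b) (o : X) (ξ η : Bord X) : 0 ≤ rho b o ξ η :=
  negPow_nonneg hb _

lemma rho_le_one {b : ℝ} (hb : 1 < b) (o : X) (ξ η : Bord X) : rho b o ξ η ≤ 1 :=
  negPow_le_one hb _

/-- Turns bounds on `rho` into lower bounds on extended Gromov products, which can be tested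
termwise under the infimum and the liminf. -/
lemma negPow_le_iff {b c : ℝ} (hb : 1 < b) (hc : 0 < c) (t : ENNReal) :
    negPow b t ≤ c ↔ ENNReal.ofReal (-Real.logb b c) ≤ t := by
  unfold negPow
  split_ifs with h
  · simp [h, hc.le]
  · rw [ENNReal.ofReal_le_iff_le_toReal h, ← Real.le_logb_iff_rpow_le hb hc]
    constructor <;> intro h <;> linarith

lemma negPow_add_ofReal {b d : ℝ} (hb : 1 < b) (hd : 0 ≤ d) (t : ENNReal) :
    negPow b t = b ^ d * negPow b (t + ENNReal.ofReal d) := by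
  unfold negPow
  by_cases h : t = ⊤
  · simp [h]
  · rw [if_neg h, if_neg (by simp [h]), ENNReal.toReal_add h ENNReal.ofReal_ne_top,
      ENNReal.toReal_ofReal hd, ← Real.rpow_add (by linarith)]
    congr 1
    ring

lemma negPow_anti {b : ℝ} (hb : 1 < b) {s t : ENNReal} (h : s ≤ t) : negPow b t ≤ negPow b s := by
  unfold negPow
  split_ifs with h1 h2 h2
  · exact le_rfl
  · positivity
  · exact absurd (top_le_iff.1 (h2 ▸ h)) h1
  · exact Real.rpow_le_rpow_of_exponent_le hb.le (neg_le_neg (ENNReal.toReal_mono h1 h))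

variable {b : ℝ}

lemma visKernel_pos (hb : 1 < b) (o x y : X) : 0 < visKernel b o x y :=
  Real.rpow_pos_of_pos (by linarith) _

lemma visKernel_le_one (hb : 1 < b) (o x y : X) : visKernel b o x y ≤ 1 :=
  Real.rpow_le_one_of_one_le_of_nonpos hb.le (by linarith [gromovProd_nonneg x y o])

lemma le_visKernel (hb : 1 < b) (o x y : X) : b ^ (-dist x o) ≤ visKernel b o x y :=
  Real.rpow_le_rpow_of_exponent_le hb.le (neg_le_neg (gromovProd_le_dist_left x y o))

lemma visKernel_le_mul (hb : 1 < b) (o x y : X) :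
    visKernel b o x y ≤ b ^ dist x y * b ^ (-dist x o) := by
  rw [visKernel, ← Real.rpow_add (by linarith)]
  exact Real.rpow_le_rpow_of_exponent_le hb.le (by linarith [dist_sub_le_gromovProd x y o])

lemma visKernel_triangle (hX : StronglyHyperbolic X b) (o x y z : X) :
    visKernel b o x z ≤ visKernel b o x y + visKernel b o y z := by
  simpa only [rho_inl_inl] using hX.triangle o (.inl x) (.inl y) (.inl z)

/-- The Ptolemaic inequality of strongly hyperbolic spaces. -/
lemma ptolemy (hX : StronglyHyperbolic X b) (o x y z : X) :
    b ^ ((dist x z + dist y o) / 2) ≤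
      b ^ ((dist x y + dist z o) / 2) + b ^ ((dist y z + dist x o) / 2) := by
  have hb : 0 < b := by linarith [hX.one_lt]
  -- This factor, symmetric in x, y and z, cancels the distances to o that the Gromov products
  -- share.
  have h := mul_le_mul_of_nonneg_left (visKernel_triangle hX o x y z)
    (Real.rpow_pos_of_pos hb ((dist x o + dist y o + dist z o) / 2)).le
  rw [mul_add] at h
  simp only [visKernel, ← Real.rpow_add hb, gromovProd] at h
  convert! h using 2
  · rw [dist_comm o z]; ring
  · congr 1
    rw [dist_comm o y]; ring
  · congr 1
    rw [dist_comm o z]; ring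

/-- Stability of the horofunctions `y ↦ d(o, y) - d(p, y)` in a strongly hyperbolic space. -/
lemma busemann_sub_le (hX : StronglyHyperbolic X b) (o p y z : X) :
    (dist o y - dist p y) - (dist o z - dist p z) ≤
      2 / Real.log b * b ^ dist o p * visKernel b o y z := by
  have hb : 0 < b := by linarith [hX.one_lt]
  have hl : 0 < Real.log b := Real.log_pos hX.one_lt
  set A := dist o y + dist p z with hA
  set B := dist p y + dist o z with hB
  set E := dist o p + dist y z with hE
  -- A - B is the horofunction difference to be bounded, and Ptolemy compares A with the other two
  -- pairings of the four points.
  have h : b ^ (A / 2) ≤ b ^ (B / 2) + b ^ (E / 2) := by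
    have h := ptolemy hX z o p y
    rw [hA, hB, hE, add_comm (dist p y), add_comm (dist o p) (dist y z), add_comm (dist y z),
      add_comm (dist o z)]
    rw [add_comm (b ^ ((dist p y + dist o z) / 2))]
    exact h
  have h1 : b ^ ((A - B) / 2) ≤ 1 + b ^ ((E - B) / 2) := by
    have h2 := mul_le_mul_of_nonneg_left h (Real.rpow_pos_of_pos hb (-(B / 2))).le
    rw [mul_add, ← Real.rpow_add hb, ← Real.rpow_add hb, ← Real.rpow_add hb] at h2
    convert! h2 using 2
    · ring
    · simp
    · congr 1; ring
  have h3 : (A - B) / 2 * Real.log b ≤ b ^ ((E - B) / 2) := by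
    have h4 := Real.add_one_le_exp (Real.log b * ((A - B) / 2))
    rw [← Real.rpow_def_of_pos hb] at h4
    linarith
  -- Replacing d(p, y) by d(o, y) costs at most d(o, p) and turns E - B into -2⟨y,z⟩_o.
  have h5 : b ^ ((E - B) / 2) ≤ b ^ dist o p * visKernel b o y z := by
    rw [visKernel, ← Real.rpow_add hb]
    apply Real.rpow_le_rpow_of_exponent_le hX.one_lt.le
    unfold gromovProd
    rw [hE, hB]
    linarith [dist_triangle o p y, dist_comm o y]
  have h6 : A - B ≤ 2 / Real.log b * (b ^ dist o p * visKernel b o y z) := by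
    rw [div_mul_eq_mul_div, le_div_iff₀ hl]
    linarith
  rw [mul_assoc]
  linarith

lemma abs_busemann_sub_le (hX : StronglyHyperbolic X b) (o p y z : X) :
    |(dist o y - dist p y) - (dist o z - dist p z)| ≤
      2 / Real.log b * b ^ dist o p * visKernel b o y z := by
  rw [abs_le]
  have h1 := busemann_sub_le hX o p y z
  have h2 := busemann_sub_le hX o p z y
  rw [visKernel_comm b o z y] at h2
  constructor <;> linarith

/-! ### The Gromov boundary -/

lemma tendsto_visKernel_iff (hb : 1 < b) {ι : Type*} {l : Filter ι} (o : X) (u v : ι → X) :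
    Tendsto (fun i => visKernel b o (u i) (v i)) l (𝓝 0) ↔
      Tendsto (fun i => gromovProd (u i) (v i) o) l atTop := by
  constructor
  · intro h
    have h1 : Tendsto (fun i => (visKernel b o (u i) (v i))⁻¹) l atTop :=
      (tendsto_nhdsWithin_iff.2
        ⟨h, Eventually.of_forall fun i => visKernel_pos hb o (u i) (v i)⟩).inv_tendsto_nhdsGT_zero
    have h2 := (Real.tendsto_logb_atTop hb).comp h1
    refine h2.congr fun i => ?_
    simp only [Function.comp, visKernel]
    rw [Real.logb_inv, Real.logb_rpow (by linarith) (by linarith), neg_neg]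
  · intro h
    exact (tendsto_rpow_atBot_of_base_gt_one b hb).comp (tendsto_neg_atTop_atBot.comp h)

lemma isGromovSeq_iff (hb : 1 < b) (o : X) (u : ℕ → X) :
    IsGromovSeq u ↔
      Tendsto (fun p : ℕ × ℕ => visKernel b o (u p.1) (u p.2)) atTop (𝓝 0) := by
  rw [tendsto_visKernel_iff hb]
  refine ⟨fun h => h o, fun h o' => ?_⟩
  refine tendsto_atTop_mono (fun p => ?_) (tendsto_atTop_add_const_right _ (-dist o o') h)
  linarith [gromovProd_le_basepoint (u p.1) (u p.2) o o']

lemma gromovEquiv_iff (hb : 1 < b) (o : X) (u v : GromovSeq X) :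
    GromovEquiv u v ↔ Tendsto (fun n => visKernel b o (u.1 n) (v.1 n)) atTop (𝓝 0) := by
  rw [tendsto_visKernel_iff hb]
  refine ⟨fun h => h o, fun h o' => ?_⟩
  refine tendsto_atTop_mono (fun p => ?_) (tendsto_atTop_add_const_right _ (-dist o o') h)
  linarith [gromovProd_le_basepoint (u.1 p) (v.1 p) o o']

/-- Transitivity is the kernel triangle inequality. It is what lets equality in the `Quot` be read
back as equivalence of sequences. -/
lemma gromovEquiv_equivalence (hX : StronglyHyperbolic X b) :
    Equivalence (GromovEquiv (X := X)) where
  refl u o := (u.2 o).comp tendsto_atTop_diagonal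
  symm {u v} h o := by simpa only [gromovProd_comm] using h o
  trans {u v w} h k o := by
    have h1 := (gromovEquiv_iff hX.one_lt o u v).1 h
    have h2 := (gromovEquiv_iff hX.one_lt o v w).1 k
    refine (tendsto_visKernel_iff hX.one_lt o u.1 w.1).1 ?_
    refine squeeze_zero (fun n => (visKernel_pos hX.one_lt _ _ _).le)
      (fun n => visKernel_triangle hX o (u.1 n) (v.1 n) (w.1 n)) ?_
    simpa using h1.add h2

lemma GromovBoundary.mk_eq_iff (hX : StronglyHyperbolic X b) (u v : GromovSeq X) :
    GromovBoundary.mk u = GromovBoundary.mk v ↔ GromovEquiv u v := by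
  constructor
  · intro h
    exact (gromovEquiv_equivalence hX).eqvGen_iff.1 (Quot.eqvGen_exact h)
  · exact fun h => Quot.sound h

/-- The product is an infimum over all representatives, but equivalent sequences are asymptotically
at kernel distance 0, so by the triangle inequality one representative controls the others. -/
lemma rho_mk_inl_le (hX : StronglyHyperbolic X b) (o x : X) (u : GromovSeq X) {c : ℝ}
    (h : ∀ᶠ m in atTop, visKernel b o (u.1 m) x ≤ c) :
    rho b o (.inr (GromovBoundary.mk u)) (.inl x) ≤ c := by
  have hb := hX.one_lt
  have hc : 0 < c := by
    obtain ⟨m, hm⟩ := h.exists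
    exact (visKernel_pos hb o (u.1 m) x).trans_le hm
  refine le_of_forall_pos_le_add fun ε hε => ?_
  have hcε : 0 < c + ε := by linarith
  rw [rho, negPow_le_iff hb hcε]
  refine le_iInf₂ fun v hv => ?_
  have huv := (gromovEquiv_iff hb o v u).1 ((GromovBoundary.mk_eq_iff hX v u).1 hv)
  refine le_liminf_of_le (by isBoundedDefault) ?_
  filter_upwards [h, huv.eventually (gt_mem_nhds hε)] with m h1 h2
  refine ENNReal.ofReal_le_ofReal ?_
  have h3 : visKernel b o (v.1 m) x ≤ c + ε := by
    linarith [visKernel_triangle hX o (v.1 m) (u.1 m) x]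
  rw [visKernel, ← Real.le_logb_iff_rpow_le hb hcε] at h3
  linarith

lemma tendsto_rho_mk (hX : StronglyHyperbolic X b) (o : X) (u : GromovSeq X) :
    Tendsto (fun n => rho b o (.inr (GromovBoundary.mk u)) (.inl (u.1 n))) atTop (𝓝 0) := by
  have hb := hX.one_lt
  have h := (isGromovSeq_iff hb o u.1).1 u.2
  rw [Metric.tendsto_atTop]
  intro ε hε
  have h1 := h.eventually (gt_mem_nhds (half_pos hε))
  rw [eventually_atTop] at h1
  obtain ⟨⟨N₁, N₂⟩, hN⟩ := h1
  refine ⟨N₂, fun n hn => ?_⟩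
  rw [Real.dist_eq, sub_zero, abs_of_nonneg (rho_nonneg hb _ _ _)]
  refine (rho_mk_inl_le hX o (u.1 n) u (c := ε / 2) ?_).trans_lt (by linarith)
  filter_upwards [eventually_ge_atTop N₁] with m hm
  exact (hN (m, n) ⟨hm, hn⟩).le

/-- The triangle inequality through points of a representing sequence avoids handling the infimum
over pairs. -/
lemma rho_self_boundary (hX : StronglyHyperbolic X b) (o : X) (ξ : GromovBoundary X) :
    rho b o (.inr ξ) (.inr ξ) = 0 := by
  obtain ⟨u, rfl⟩ := Quot.exists_rep ξ
  refine le_antisymm ?_ (rho_nonneg hX.one_lt _ _ _)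
  have h := tendsto_rho_mk hX o u
  have h2 := h.add h
  rw [add_zero] at h2
  refine ge_of_tendsto' h2 fun n => ?_
  exact hX.triangle o _ (.inl (u.1 n)) _

lemma rho_inl_inr_le_mul (hb : 1 < b) (o x y : X) (η : GromovBoundary X) :
    rho b o (.inl x) (.inr η) ≤ b ^ dist x y * rho b o (.inl y) (.inr η) := by
  unfold rho
  rw [negPow_add_ofReal hb (dist_nonneg (x := x) (y := y)) (gromovProdBord o (.inl x) (.inr η))]
  refine mul_le_mul_of_nonneg_left (negPow_anti hb ?_) (by positivity)
  simp only [gromovProdBord, ENNReal.iInf_add]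
  refine iInf₂_mono fun v _ => ?_
  rw [← liminf_add_const _ _ _ (by isBoundedDefault) (by isBoundedDefault)]
  refine liminf_le_liminf (Eventually.of_forall fun n => ?_)
    (by isBoundedDefault) (by isBoundedDefault)
  rw [← ENNReal.ofReal_add (gromovProd_nonneg _ _ _) dist_nonneg]
  refine ENNReal.ofReal_le_ofReal ?_
  rw [dist_comm x y]
  exact gromovProd_le_add_dist (v.1 n) y x o

end Geometry

/-! ### The distance on the isometry group and pointwise evaluation. -/

section Group

variable {X : Type*} [MetricSpace X] {b : ℝ} {x₀ : X}

lemma visualDist_le_one (hb : 1 < b) (x₀ : X) (ξ η : Bord X) : visualDist b x₀ ξ η ≤ 1 := by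
  rcases ξ with x | ξ <;> rcases η with y | η
  · exact (min_le_right _ _).trans (rho_le_one hb _ _ _)
  all_goals exact rho_le_one hb _ _ _

lemma dG_le_one (hb : 1 < b) (x₀ : X) (g₁ g₂ : X ≃ᵢ X) : dG b x₀ g₁ g₂ ≤ 1 := by
  have : Nonempty (Bord X) := ⟨.inl x₀⟩
  exact max_le (ciSup_le fun _ => visualDist_le_one hb _ _ _)
    (ciSup_le fun _ => visualDist_le_one hb _ _ _)

lemma visualDist_le_dG (hb : 1 < b) (x₀ : X) (g₁ g₂ : X ≃ᵢ X) (ξ : Bord X) :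
    visualDist b x₀ (bordMap g₁ ξ) (bordMap g₂ ξ) ≤ dG b x₀ g₁ g₂ :=
  (le_ciSup (f := fun ξ => visualDist b x₀ (bordMap g₁ ξ) (bordMap g₂ ξ))
    ⟨1, by rintro _ ⟨ζ, rfl⟩; exact visualDist_le_one hb _ _ _⟩ ξ).trans (le_max_left _ _)

/-- The kernel term of the minimum is at least b^(-d(g₁ x, x₀)) > δ, so the metric term must be the
small one. -/
lemma dist_apply_le_of_dG_le (hb : 1 < b) {g₁ g₂ : X ≃ᵢ X} {δ : ℝ} (h : dG b x₀ g₁ g₂ ≤ δ) (x : X)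
    (hδ : δ < b ^ (-dist (g₁ x) x₀)) : dist (g₁ x) (g₂ x) ≤ δ / Real.log b := by
  have h1 := (visualDist_le_dG hb x₀ g₁ g₂ (.inl x)).trans h
  change min (Real.log b * dist (g₁ x) (g₂ x)) (rho b x₀ (.inl (g₁ x)) (.inl (g₂ x))) ≤ δ at h1
  rw [rho_inl_inl] at h1
  have h2 := le_visKernel hb x₀ (g₁ x) (g₂ x)
  rw [le_div_iff₀ (Real.log_pos hb)]
  rcases min_le_iff.1 h1 with h3 | h3 <;> linarith

/-- Evaluation at a point of `X` is continuous on the isometry group. -/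
lemma continuous_eval (hb : 1 < b) (x : X) :
    @Continuous (X ≃ᵢ X) X (distTopology (dG b x₀)) _ (fun g => g x) := by
  let := distTopology (dG b x₀)
  refine continuous_def.2 fun U hU => ?_
  intro g hg
  obtain ⟨ε, hε, hball⟩ := Metric.isOpen_iff.1 hU (g x) hg
  have hl := Real.log_pos hb
  refine ⟨min (b ^ (-dist (g x) x₀)) (ε * Real.log b), by positivity, fun g' hg' => hball ?_⟩
  have h := dist_apply_le_of_dG_le hb le_rfl x (hg'.trans_le (min_le_left _ _))
  rw [Metric.mem_ball, dist_comm]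
  refine h.trans_lt ?_
  rw [div_lt_iff₀ hl]
  exact hg'.trans_le (min_le_right _ _)

end Group

/-! ### Orbits, their measurability, and the drift. -/

section Orbit

variable {X : Type*} [MetricSpace X] {Ω : Type*} [MeasurableSpace Ω] {b : ℝ} {x₀ : X}
  {T : Ω → Ω} {μ : Measure Ω}

/-- The path `g^{(n)}(ω) x₀`. -/
def orbit (T : Ω → Ω) (g : BddCocycle Ω b x₀) (n : ℕ) (ω : Ω) : X := iter T g.toFun n ω x₀

lemma orbit_zero (g : BddCocycle Ω b x₀) (ω : Ω) : orbit T g 0 ω = x₀ := rfl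

omit [MeasurableSpace Ω] in
lemma iter_add (g : Ω → (X ≃ᵢ X)) (m n : ℕ) (ω : Ω) :
    iter T g (m + n) ω = iter T g m ω * iter T g n (T^[m] ω) := by
  induction n with
  | zero => simp [iter]
  | succ n ih => rw [← add_assoc, iter, iter, ih, mul_assoc, ← Function.iterate_add_apply,
      add_comm n m]

lemma orbit_add (g : BddCocycle Ω b x₀) (m n : ℕ) (ω : Ω) :
    orbit T g (m + n) ω = iter T g.toFun m ω (orbit T g n (T^[m] ω)) := by
  rw [orbit, iter_add]; rfl

omit [MeasurableSpace Ω] in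
lemma iter_one (g : Ω → (X ≃ᵢ X)) (ω : Ω) : iter T g 1 ω = g ω := by
  simp [iter]

lemma orbit_one (g : BddCocycle Ω b x₀) (ω : Ω) : orbit T g 1 ω = g.toFun ω x₀ := by
  rw [orbit, iter_one]

lemma orbit_succ (g : BddCocycle Ω b x₀) (n : ℕ) (ω : Ω) :
    orbit T g (n + 1) ω = g.toFun ω (orbit T g n (T ω)) := by
  rw [add_comm, orbit_add, iter_one]; rfl

lemma dist_orbit_add (g : BddCocycle Ω b x₀) (m n : ℕ) (ω : Ω) :
    dist (orbit T g m ω) (orbit T g (m + n) ω) = dist (orbit T g n (T^[m] ω)) x₀ := by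
  rw [orbit_add, dist_comm (orbit T g n _) x₀]
  exact (iter T g.toFun m ω).dist_eq x₀ _

lemma dist_orbit_add_le (g : BddCocycle Ω b x₀) (m n : ℕ) (ω : Ω) :
    dist (orbit T g (m + n) ω) x₀ ≤ dist (orbit T g m ω) x₀ + dist (orbit T g n (T^[m] ω)) x₀ := by
  rw [← dist_orbit_add g m n ω]
  linarith [dist_triangle (orbit T g (m + n) ω) (orbit T g m ω) x₀,
    dist_comm (orbit T g (m + n) ω) (orbit T g m ω)]

lemma dist_orbit_le {g : BddCocycle Ω b x₀} {M : ℝ} {ω : Ω}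
    (h : ∀ j, dist (g.toFun (T^[j] ω) x₀) x₀ ≤ M) (n : ℕ) : dist (orbit T g n ω) x₀ ≤ n * M := by
  induction n with
  | zero => simp [orbit_zero]
  | succ n ih =>
    have h1 := dist_orbit_add_le g n 1 ω (T := T)
    rw [orbit_one] at h1
    push_cast
    linarith [h n]

lemma exists_step_bound (hb : 1 < b) (g : BddCocycle Ω b x₀) :
    ∃ M, 1 ≤ M ∧ ∀ ω, dist (g.toFun ω x₀) x₀ ≤ M := by
  obtain ⟨B, hB⟩ := g.bounded
  refine ⟨max 1 (Real.logb b (max B 1)), le_max_left _ _, fun ω => le_max_of_le_right ?_⟩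
  rw [Real.le_logb_iff_rpow_le hb (by positivity)]
  exact le_max_of_le_left (hB ⟨ω, rfl⟩)

section Measurability

variable [TopologicalSpace.SeparableSpace X] [MeasurableSpace X] [BorelSpace X]

lemma measurable_orbit (hb : 1 < b) (hT : Measurable T) (g : BddCocycle Ω b x₀) (n : ℕ) :
    Measurable (orbit T g n) := by
  have := UniformSpace.secondCountable_of_separable X
  have heval : ∀ x, Measurable fun ω => g.toFun ω x := fun x => by
    let := distTopology (dG b x₀)
    let := distBorel (dG b x₀)
    have : BorelSpace (X ≃ᵢ X) := ⟨rfl⟩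
    exact (continuous_eval hb x).measurable.comp g.measurable
  -- A Carathéodory function, continuous in x and measurable in ω, is jointly measurable; no
  -- measurability of products in the group is needed.
  have hjoint : Measurable (Function.uncurry fun (x : X) (ω : Ω) => g.toFun ω x) :=
    measurable_uncurry_of_continuous_of_measurable (fun ω => (g.toFun ω).continuous) heval
  induction n with
  | zero => exact measurable_const
  | succ n ih =>
    have : orbit T g (n + 1) = (Function.uncurry fun (x : X) (ω : Ω) => g.toFun ω x) ∘
        fun ω => (orbit T g n (T ω), ω) := by
      funext ω
      exact orbit_succ g n ω
    rw [this]
    exact hjoint.comp ((ih.comp hT).prodMk measurable_id)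

lemma measurable_dist_orbit (hb : 1 < b) (hT : Measurable T) (g : BddCocycle Ω b x₀) (n : ℕ) :
    Measurable fun ω => dist (orbit T g n ω) x₀ :=
  (measurable_orbit hb hT g n).dist measurable_const

lemma measurable_visKernel_orbit (hb : 1 < b) (hT : Measurable T) (g₁ g₂ : BddCocycle Ω b x₀)
    (m n : ℕ) : Measurable fun ω => visKernel b x₀ (orbit T g₁ m ω) (orbit T g₂ n ω) := by
  have := UniformSpace.secondCountable_of_separable X
  have h₁ := measurable_orbit hb hT g₁ m
  have h₂ := measurable_orbit hb hT g₂ n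
  have h : Measurable fun ω => gromovProd (orbit T g₁ m ω) (orbit T g₂ n ω) x₀ := by
    unfold gromovProd
    exact (((h₁.dist measurable_const).add (measurable_const.dist h₂)).sub
      (h₁.dist h₂)).div_const 2
  exact measurable_const.pow h.neg

end Measurability

/-- The displacement `∫ d(g^{(n)}(ω) x₀, x₀) dμ(ω)`. -/
noncomputable def displacement (T : Ω → Ω) (μ : Measure Ω) (g : BddCocycle Ω b x₀) (n : ℕ) : ℝ :=
  ∫ ω, dist (orbit T g n ω) x₀ ∂μ

lemma finDrift_eq (g : BddCocycle Ω b x₀) :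
    finDrift T μ g = fun n : ℕ => displacement T μ g n / n := by
  funext n
  rw [finDrift, displacement, one_div, inv_mul_eq_div]
  rfl

section Drift

variable [TopologicalSpace.SeparableSpace X] [IsProbabilityMeasure μ]

lemma integrable_dist_orbit (hb : 1 < b) (hT : Measurable T) (g : BddCocycle Ω b x₀) (n : ℕ) :
    Integrable (fun ω => dist (orbit T g n ω) x₀) μ := by
  let := borel X
  have : BorelSpace X := ⟨rfl⟩
  obtain ⟨M, -, hM⟩ := exists_step_bound hb g
  refine Integrable.of_bound (measurable_dist_orbit hb hT g n).aestronglyMeasurable (n * M)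
    (Eventually.of_forall fun ω => ?_)
  rw [Real.norm_of_nonneg dist_nonneg]
  exact dist_orbit_le (fun j => hM _) n

omit [TopologicalSpace.SeparableSpace X] [IsProbabilityMeasure μ] in
lemma displacement_nonneg (g : BddCocycle Ω b x₀) (n : ℕ) : 0 ≤ displacement T μ g n :=
  integral_nonneg fun _ => dist_nonneg

omit [IsProbabilityMeasure μ] in
lemma integral_dist_orbit_comp (hb : 1 < b) (hT : MeasurePreserving T μ μ) (g : BddCocycle Ω b x₀)
    (m n : ℕ) : ∫ ω, dist (orbit T g n (T^[m] ω)) x₀ ∂μ = displacement T μ g n := by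
  let := borel X
  have : BorelSpace X := ⟨rfl⟩
  have h := (hT.iterate m).map_eq
  rw [displacement]
  conv_rhs => rw [← h]
  rw [integral_map (hT.iterate m).measurable.aemeasurable]
  exact (measurable_dist_orbit hb hT.measurable g n).aestronglyMeasurable

lemma integrable_dist_orbit_comp (hb : 1 < b) (hT : MeasurePreserving T μ μ)
    (g : BddCocycle Ω b x₀) (m n : ℕ) :
    Integrable (fun ω => dist (orbit T g n (T^[m] ω)) x₀) μ :=
  (hT.iterate m).integrable_comp_of_integrable (integrable_dist_orbit hb hT.measurable g n)

lemma subadditive_displacement (hb : 1 < b) (hT : MeasurePreserving T μ μ)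
    (g : BddCocycle Ω b x₀) : Subadditive (displacement T μ g) := by
  intro m n
  rw [← integral_dist_orbit_comp hb hT g m n]
  unfold displacement
  rw [← integral_add (integrable_dist_orbit hb hT.measurable g m)
    (integrable_dist_orbit_comp hb hT g m n)]
  exact integral_mono (integrable_dist_orbit hb hT.measurable g _)
    ((integrable_dist_orbit hb hT.measurable g m).add (integrable_dist_orbit_comp hb hT g m n))
    fun ω => dist_orbit_add_le g m n ω

/-- Fekete's lemma. The lower bound by the limit at every scale is used as much as the convergence.
-/
lemma tendsto_displacement_div (hb : 1 < b) (hT : MeasurePreserving T μ μ)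
    (g : BddCocycle Ω b x₀) :
    Tendsto (fun n : ℕ => displacement T μ g n / n) atTop (𝓝 (drift T μ g)) ∧
      ∀ n : ℕ, n ≠ 0 → drift T μ g ≤ displacement T μ g n / n := by
  have hs := subadditive_displacement hb hT g
  have hbdd : BddBelow (range fun n : ℕ => displacement T μ g n / n) :=
    ⟨0, by rintro _ ⟨n, rfl⟩; exact div_nonneg (displacement_nonneg g n) n.cast_nonneg⟩
  have h := hs.tendsto_lim hbdd
  have h2 : drift T μ g = hs.lim := by
    rw [drift, finDrift_eq]
    exact h.limUnder_eq
  rw [h2]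
  exact ⟨h, fun n hn => hs.lim_le_div hbdd hn⟩

lemma drift_nonneg (hb : 1 < b) (hT : MeasurePreserving T μ μ) (g : BddCocycle Ω b x₀) :
    0 ≤ drift T μ g :=
  ge_of_tendsto' (tendsto_displacement_div hb hT g).1 fun n =>
    div_nonneg (displacement_nonneg g n) n.cast_nonneg

end Drift

/-! ### Comparison of cocycles -/

/-- Errors add up because isometries do not expand them. The bound on δ keeps the points involved,
within nM of x₀, in the range where `dG` controls the metric. -/
lemma dist_orbit_orbit_le (hb : 1 < b) {g₁ g₂ : BddCocycle Ω b x₀} {δ M : ℝ} (hM : 0 ≤ M) (n : ℕ)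
    (hδ : δ < b ^ (-(n * M))) (ω : Ω)
    (h : ∀ j, dG b x₀ (g₁.toFun (T^[j] ω)) (g₂.toFun (T^[j] ω)) ≤ δ)
    (h₁ : ∀ j, dist (g₁.toFun (T^[j] ω) x₀) x₀ ≤ M)
    (h₂ : ∀ j, dist (g₂.toFun (T^[j] ω) x₀) x₀ ≤ M) :
    dist (orbit T g₁ n ω) (orbit T g₂ n ω) ≤ n * (δ / Real.log b) := by
  induction n generalizing ω with
  | zero => simp [orbit_zero]
  | succ n ih =>
    have hmono : b ^ (-((n + 1 : ℕ) * M)) ≤ b ^ (-(n * M)) :=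
      Real.rpow_le_rpow_of_exponent_le hb.le (by push_cast; linarith)
    have h3 := ih (hδ.trans_le hmono) (T ω) (fun j => h (j + 1)) (fun j => h₁ (j + 1))
      (fun j => h₂ (j + 1))
    rw [orbit_succ, orbit_succ]
    set y := orbit T g₂ n (T ω)
    have h4 : dist y x₀ ≤ n * M := dist_orbit_le (fun j => h₂ (j + 1)) n
    have h5 : dist (g₁.toFun ω y) x₀ ≤ (n + 1 : ℕ) * M := by
      have h6 := dist_triangle (g₁.toFun ω y) (g₁.toFun ω x₀) x₀
      rw [(g₁.toFun ω).dist_eq] at h6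
      push_cast
      linarith [h₁ 0, show dist (g₁.toFun ω x₀) x₀ ≤ M from h₁ 0]
    have h7 := dist_apply_le_of_dG_le hb (h 0) y (hδ.trans_le
      (Real.rpow_le_rpow_of_exponent_le hb.le (neg_le_neg h5)))
    have h8 := dist_triangle (g₁.toFun ω (orbit T g₁ n (T ω))) (g₁.toFun ω y) (g₂.toFun ω y)
    rw [(g₁.toFun ω).dist_eq] at h8
    change dist (g₁.toFun ω y) (g₂.toFun ω y) ≤ _ at h7
    push_cast
    linarith

lemma ae_dG_le_dInfty (hb : 1 < b) (g₁ g₂ : BddCocycle Ω b x₀) :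
    ∀ᵐ ω ∂μ, dG b x₀ (g₁.toFun ω) (g₂.toFun ω) ≤ dInfty μ g₁ g₂ :=
  ae_le_essSup (isBoundedUnder_of ⟨1, fun _ => dG_le_one hb _ _ _⟩)

lemma ae_orbit_of_ae (hT : MeasurePreserving T μ μ) {p : Ω → Prop} (h : ∀ᵐ ω ∂μ, p ω) :
    ∀ᵐ ω ∂μ, ∀ j, p (T^[j] ω) :=
  ae_all_iff.2 fun j => (hT.iterate j).quasiMeasurePreserving.ae h

/-- Almost sure bound `M` for the steps of the path. -/
def StepBound (T : Ω → Ω) (μ : Measure Ω) (M : ℝ) (g : BddCocycle Ω b x₀) : Prop :=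
  ∀ᵐ ω ∂μ, ∀ j, dist (g.toFun (T^[j] ω) x₀) x₀ ≤ M

/-- Step bounds are locally uniform. -/
lemma exists_uniform_stepBound (hb : 1 < b) (hT : MeasurePreserving T μ μ)
    (g : BddCocycle Ω b x₀) :
    ∃ M, 1 ≤ M ∧ ∃ r > 0, ∀ g₁ : BddCocycle Ω b x₀, dInfty μ g g₁ < r → StepBound T μ M g₁ := by
  obtain ⟨M, hM1, hM⟩ := exists_step_bound hb g
  have hl := Real.log_pos hb
  -- Below b^(-M), `dG` controls the displacement of g(ω)x₀; below log b, that displacement is at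
  -- most 1.
  refine ⟨M + 1, by linarith, min (b ^ (-M)) (Real.log b), by positivity, fun g₁ hg₁ => ?_⟩
  refine ae_orbit_of_ae hT (p := fun ω => dist (g₁.toFun ω x₀) x₀ ≤ M + 1) ((ae_dG_le_dInfty hb g g₁).mono fun ω hω => ?_)
  have h1 := dist_apply_le_of_dG_le hb hω x₀ ((hg₁.trans_le (min_le_left _ _)).trans_le
    (Real.rpow_le_rpow_of_exponent_le hb.le (neg_le_neg (hM ω))))
  have h2 : dInfty μ g g₁ / Real.log b ≤ 1 :=
    (div_le_one hl).2 (hg₁.trans_le (min_le_right _ _)).le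
  linarith [dist_triangle (g₁.toFun ω x₀) (g.toFun ω x₀) x₀, hM ω,
    dist_comm (g₁.toFun ω x₀) (g.toFun ω x₀)]

lemma ae_dist_orbit_orbit_le (hb : 1 < b) (hT : MeasurePreserving T μ μ)
    {g₁ g₂ : BddCocycle Ω b x₀} {δ M : ℝ} (hM : 0 ≤ M) (n : ℕ) (hδ : δ < b ^ (-(n * M)))
    (h : dInfty μ g₁ g₂ ≤ δ) (h₁ : StepBound T μ M g₁) (h₂ : StepBound T μ M g₂) :
    ∀ᵐ ω ∂μ, dist (orbit T g₁ n ω) (orbit T g₂ n ω) ≤ n * (δ / Real.log b) := by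
  filter_upwards [ae_orbit_of_ae hT ((ae_dG_le_dInfty hb g₁ g₂).mono fun ω hω => hω.trans h),
    h₁, h₂] with ω h3 h4 h5
  exact dist_orbit_orbit_le hb hM n hδ ω h3 h4 h5

lemma abs_displacement_sub_le [TopologicalSpace.SeparableSpace X] [IsProbabilityMeasure μ]
    (hb : 1 < b) (hT : MeasurePreserving T μ μ)
    {g₁ g₂ : BddCocycle Ω b x₀} {δ M : ℝ} (hM : 0 ≤ M) (n : ℕ) (hδ : δ < b ^ (-(n * M)))
    (h : dInfty μ g₁ g₂ ≤ δ) (h₁ : StepBound T μ M g₁) (h₂ : StepBound T μ M g₂) :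
    |displacement T μ g₁ n - displacement T μ g₂ n| ≤ n * (δ / Real.log b) := by
  unfold displacement
  rw [← integral_sub (integrable_dist_orbit hb hT.measurable g₁ n)
    (integrable_dist_orbit hb hT.measurable g₂ n), ← Real.norm_eq_abs]
  refine (norm_integral_le_of_norm_le_const (C := n * (δ / Real.log b)) ?_).trans (by simp)
  filter_upwards [ae_dist_orbit_orbit_le hb hT hM n hδ h h₁ h₂] with ω hω
  exact (abs_dist_sub_le _ _ _).trans hω

end Orbit

/-! ### Real sequences: bootstrapping growth, and from geometric to Hölder bounds. -/

section RealSequences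

/-- A sequence whose increments vary by exponentially little keeps growing linearly, as long as the
control of the increments is guaranteed by the growth itself. -/
lemma linear_growth_of_increments {u : ℕ → ℝ} {K β L : ℝ} {N : ℕ} (hβ : β < 1)
    (hK : 0 ≤ K) (hβ0 : 0 ≤ β) (h0 : N * L ≤ u N)
    (h1 : L + K * β ^ N / (1 - β) ≤ u (N + 1) - u N)
    (h : ∀ n ≥ N, ((n + 1 : ℕ) : ℝ) * L ≤ u (n + 1) →
      |(u (n + 2) - u (n + 1)) - (u (n + 1) - u n)| ≤ K * β ^ n) :
    ∀ n ≥ N, n * L ≤ u n := by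
  have hpos : 0 < 1 - β := by linarith
  -- The strengthened induction keeps the increment above L by the whole remaining geometric tail;
  -- each step spends one term of it.
  suffices H : ∀ n ≥ N, n * L ≤ u n ∧ L + K * β ^ n / (1 - β) ≤ u (n + 1) - u n from
    fun n hn => (H n hn).1
  intro n hn
  induction n, hn using Nat.le_induction with
  | base => exact ⟨h0, h1⟩
  | succ n hn ih =>
    have h2 : ((n + 1 : ℕ) : ℝ) * L ≤ u (n + 1) := by
      have : 0 ≤ K * β ^ n / (1 - β) := by positivity
      push_cast
      linarith [ih.1, ih.2]
    refine ⟨h2, ?_⟩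
    have h3 := (abs_le.1 (h n hn h2)).1
    have h4 : K * β ^ n / (1 - β) - K * β ^ n = K * β ^ (n + 1) / (1 - β) := by
      field_simp
      ring
    change _ ≤ u (n + 2) - u (n + 1)
    linarith [ih.2]

lemma abs_increment_sub_le {u : ℕ → ℝ} {K β l : ℝ} {N : ℕ} (hβ : β < 1)
    (h : ∀ n ≥ N, |(u (n + 2) - u (n + 1)) - (u (n + 1) - u n)| ≤ K * β ^ n)
    (hl : Tendsto (fun n : ℕ => u n / n) atTop (𝓝 l)) {n : ℕ} (hn : N ≤ n) :
    |u (n + 1) - u n - l| ≤ K * β ^ n / (1 - β) := by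
  set a : ℕ → ℝ := fun k => u (k + 1) - u k with ha
  have hgeo : ∀ k, dist (a (k + N)) (a (k + 1 + N)) ≤ K * β ^ N * β ^ k := fun k => by
    rw [dist_comm, Real.dist_eq, mul_assoc, ← pow_add, add_comm N k]
    have := h (k + N) (by omega)
    simp only [ha]
    rwa [show k + 1 + N + 1 = k + N + 2 by ring, show k + 1 + N = k + N + 1 by ring]
  obtain ⟨l', hl'⟩ := cauchySeq_tendsto_of_complete (cauchySeq_of_le_geometric β _ hβ hgeo)
  have ha' : Tendsto a atTop (𝓝 l') := (tendsto_add_atTop_iff_nat N).1 hl'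
  -- The Cesàro means of the increments are (u n - u 0)/n, which identifies their limit with l.
  have hces := ha'.cesaro
  have hu0 : Tendsto (fun n : ℕ => u 0 / (n : ℝ)) atTop (𝓝 0) :=
    tendsto_const_div_atTop_nhds_zero_nat _
  have hll : l = l' := by
    have h1 := hl.sub hu0
    rw [sub_zero] at h1
    refine tendsto_nhds_unique h1 (hces.congr fun n => ?_)
    rw [Finset.sum_range_sub, inv_mul_eq_div, sub_div]
  have h2 := dist_le_of_le_geometric_of_tendsto β _ hβ hgeo hl' (n - N)
  rw [Nat.sub_add_cancel hn, Real.dist_eq, mul_assoc, ← pow_add, Nat.add_sub_cancel' hn] at h2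
  rwa [hll]

/-- Interpolation: an exponentially small bound valid down to an exponentially small scale is a
Hölder bound. -/
lemma holder_of_geometric {B α K F₀ : ℝ} (hB : 1 < B) (hα : 0 < α) (hK : 0 ≤ K) (hF₀ : 0 ≤ F₀)
    (N : ℕ) {F δ : ℝ} (hδ0 : 0 ≤ δ) (hF : F ≤ F₀)
    (h : ∀ n ≥ N, δ ≤ B⁻¹ ^ n → F ≤ K * (B ^ (-α)) ^ n) :
    F ≤ (F₀ * (B ^ α) ^ N + K * B ^ α) * δ ^ α := by
  have hB0 : 0 < B := by linarith
  have hBi : B⁻¹ < 1 := inv_lt_one_of_one_lt₀ hB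
  have hpow : ∀ n : ℕ, (B⁻¹ ^ n) ^ α = (B ^ (-α)) ^ n := fun n => by
    rw [← Real.rpow_natCast, ← Real.rpow_mul (by positivity), mul_comm, Real.rpow_mul (by positivity),
      Real.inv_rpow hB0.le, ← Real.rpow_neg hB0.le, Real.rpow_natCast]
  have hone : ∀ n : ℕ, (B ^ α) ^ n * (B⁻¹ ^ n) ^ α = 1 := fun n => by
    rw [hpow, ← mul_pow, ← Real.rpow_add hB0, add_neg_cancel, Real.rpow_zero, one_pow]
  have hrhs : F₀ * (B ^ α) ^ N * δ ^ α ≤ (F₀ * (B ^ α) ^ N + K * B ^ α) * δ ^ α := by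
    rw [add_mul]
    have : 0 ≤ K * B ^ α * δ ^ α := by positivity
    linarith
  -- For large δ the a priori bound F₀ suffices; for small δ > 0 take n with B^(-(n+1)) < δ ≤
  -- B^(-n); for δ = 0 let n tend to infinity.
  by_cases hδN : B⁻¹ ^ N ≤ δ
  · refine le_trans ?_ hrhs
    calc F ≤ F₀ * 1 := by linarith
      _ = F₀ * ((B ^ α) ^ N * (B⁻¹ ^ N) ^ α) := by rw [hone]
      _ ≤ F₀ * ((B ^ α) ^ N * δ ^ α) := by gcongr
      _ = _ := by ring
  push Not at hδN
  rcases hδ0.eq_or_lt with rfl | hδ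
  · rw [Real.zero_rpow hα.ne', mul_zero]
    have hlim : Tendsto (fun n : ℕ => K * (B ^ (-α)) ^ n) atTop (𝓝 0) := by
      simpa using (tendsto_pow_atTop_nhds_zero_of_lt_one (by positivity)
        (Real.rpow_lt_one_of_one_lt_of_neg hB (neg_lt_zero.2 hα))).const_mul K
    refine ge_of_tendsto hlim ?_
    filter_upwards [eventually_ge_atTop N] with n hn
    exact h n hn (by positivity)
  · obtain ⟨n, hn1, hn2⟩ := exists_nat_pow_near_of_lt_one hδ
      (hδN.le.trans (pow_le_one₀ (by positivity) hBi.le)) (by positivity) hBi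
    have hnN : N ≤ n := by
      by_contra hlt
      have := pow_le_pow_of_le_one (by positivity) hBi.le (show n + 1 ≤ N by omega)
      linarith
    calc F ≤ K * (B ^ (-α)) ^ n := h n hnN hn2
      _ = K * B ^ α * (B⁻¹ ^ (n + 1)) ^ α := by
        have h1 : B ^ α * B ^ (-α) = 1 := by
          rw [← Real.rpow_add hB0, add_neg_cancel, Real.rpow_zero]
        rw [hpow, pow_succ]
        linear_combination (-K * (B ^ (-α)) ^ n) * h1
      _ ≤ K * B ^ α * δ ^ α := by gcongr
      _ ≤ _ := by
        rw [add_mul]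
        have : 0 ≤ F₀ * (B ^ α) ^ N * δ ^ α := by positivity
        linarith

end RealSequences

/-! ### Exponential decay of the visual kernel along orbits. -/

section Decay

variable {X : Type*} [MetricSpace X] [TopologicalSpace.SeparableSpace X]
  {Ω : Type*} [MeasurableSpace Ω] {b : ℝ} {x₀ : X}
  {T : Ω → Ω} {μ : Measure Ω} [IsProbabilityMeasure μ]

lemma integrable_rpow_neg_dist_orbit (hb : 1 < b) (hT : Measurable T) (g : BddCocycle Ω b x₀)
    (n : ℕ) : Integrable (fun ω => b ^ (-dist (orbit T g n ω) x₀)) μ := by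
  let := borel X
  have : BorelSpace X := ⟨rfl⟩
  refine Integrable.of_bound
    (measurable_const.pow (measurable_dist_orbit hb hT g n).neg).aestronglyMeasurable 1
    (Eventually.of_forall fun ω => ?_)
  rw [Real.norm_of_nonneg (by positivity)]
  exact Real.rpow_le_one_of_one_le_of_nonpos hb.le (neg_nonpos.2 dist_nonneg)

lemma integrable_visKernel_orbit (hb : 1 < b) (hT : Measurable T) (g₁ g₂ : BddCocycle Ω b x₀)
    (m n : ℕ) : Integrable (fun ω => visKernel b x₀ (orbit T g₁ m ω) (orbit T g₂ n ω)) μ := by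
  let := borel X
  have : BorelSpace X := ⟨rfl⟩
  refine Integrable.of_bound (measurable_visKernel_orbit hb hT g₁ g₂ m n).aestronglyMeasurable 1
    (Eventually.of_forall fun ω => ?_)
  rw [Real.norm_of_nonneg (visKernel_pos hb _ _ _).le]
  exact visKernel_le_one hb _ _ _

/-- `∫ b ^ (-d(g^{(n)} x₀, x₀)) dμ ≤ 2 β ^ n` from scale `N` on. -/
def ExpDecay (T : Ω → Ω) (μ : Measure Ω) (β : ℝ) (N : ℕ) (g : BddCocycle Ω b x₀) : Prop :=
  ∀ n ≥ N, ∫ ω, b ^ (-dist (orbit T g n ω) x₀) ∂μ ≤ 2 * β ^ n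

/-- A large deviation estimate and linear growth of the mean displacement give exponential decay. -/
lemma integral_rpow_neg_dist_orbit_le (hb : 1 < b) (hT : Measurable T) (g : BddCocycle Ω b x₀)
    {n : ℕ} (hn : n ≠ 0) {L s κ : ℝ} (hL : n * L ≤ displacement T μ g n)
    (hκL : κ ≤ L / 2) (hκs : κ ≤ s)
    (h : μ.real {ω | L / 2 < |1 / (n : ℝ) * dist (iter T g.toFun n ω x₀) x₀ - finDrift T μ g n|}
      < b ^ (-(s * n))) :
    ∫ ω, b ^ (-dist (orbit T g n ω) x₀) ∂μ ≤ 2 * (b ^ (-κ)) ^ n := by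
  let := borel X
  have : BorelSpace X := ⟨rfl⟩
  have hn0 : (0 : ℝ) < n := by positivity
  set S : Set Ω :=
    {ω | L / 2 < |1 / (n : ℝ) * dist (iter T g.toFun n ω x₀) x₀ - finDrift T μ g n|} with hS
  have hSm : MeasurableSet S := by
    refine measurableSet_lt measurable_const ?_
    exact
      (((measurable_dist_orbit hb hT g n).const_mul (1 / (n : ℝ))).sub_const _).norm
  have hpow : ∀ t : ℝ, κ ≤ t → b ^ (-(t * n)) ≤ (b ^ (-κ)) ^ n := fun t ht => by
    rw [← Real.rpow_natCast, ← Real.rpow_mul (by linarith)]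
    exact Real.rpow_le_rpow_of_exponent_le hb.le (by nlinarith)
  -- On the deviation set the integrand is at most 1; off it the distance is at least nL/2 ≥ κn.
  have hpt : ∀ ω, b ^ (-dist (orbit T g n ω) x₀) ≤ (b ^ (-κ)) ^ n + S.indicator (fun _ => 1) ω := by
    intro ω
    by_cases hω : ω ∈ S
    · rw [indicator_of_mem hω]
      have h1 : b ^ (-dist (orbit T g n ω) x₀) ≤ 1 :=
        Real.rpow_le_one_of_one_le_of_nonpos hb.le (neg_nonpos.2 dist_nonneg)
      have h2 : 0 ≤ (b ^ (-κ)) ^ n := by positivity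
      linarith
    · rw [indicator_of_notMem hω, add_zero]
      refine le_trans ?_ (hpow (L / 2) hκL)
      refine Real.rpow_le_rpow_of_exponent_le hb.le (neg_le_neg ?_)
      have h1 := (abs_le.1 (not_lt.1 (notMem_ofPred_iff.1 hω))).1
      rw [finDrift_eq] at h1
      have h2 : L ≤ displacement T μ g n / n := by
        rw [le_div_iff₀ hn0]
        linarith
      have h3 : L / 2 ≤ dist (iter T g.toFun n ω x₀) x₀ / n := by
        rw [one_div, inv_mul_eq_div] at h1
        linarith
      exact (le_div_iff₀ hn0).1 h3
  have hind : Integrable (S.indicator fun _ => (1 : ℝ)) μ := (integrable_const 1).indicator hSm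
  calc ∫ ω, b ^ (-dist (orbit T g n ω) x₀) ∂μ
      ≤ ∫ ω, ((b ^ (-κ)) ^ n + S.indicator (fun _ => 1) ω) ∂μ :=
        integral_mono (integrable_rpow_neg_dist_orbit hb hT g n)
          ((integrable_const _).add hind) hpt
    _ = (b ^ (-κ)) ^ n + μ.real S := by
        rw [integral_add (integrable_const _) hind, integral_const,
          integral_indicator_const _ hSm]
        simp
    _ ≤ _ := by linarith [hpow s hκs]

lemma integral_visKernel_succ_le (hb : 1 < b) (hT : Measurable T) {g : BddCocycle Ω b x₀} {M : ℝ}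
    (hM : StepBound T μ M g) (n : ℕ) :
    ∫ ω, visKernel b x₀ (orbit T g n ω) (orbit T g (n + 1) ω) ∂μ ≤
      b ^ M * ∫ ω, b ^ (-dist (orbit T g n ω) x₀) ∂μ := by
  rw [← integral_const_mul]
  refine integral_mono_ae (integrable_visKernel_orbit hb hT g g n (n + 1))
    ((integrable_rpow_neg_dist_orbit hb hT g n).const_mul _) ?_
  filter_upwards [hM] with ω hω
  refine (visKernel_le_mul hb _ _ _).trans ?_
  gcongr
  · exact hb.le
  · rw [dist_orbit_add, orbit_one]
    exact hω n

/-- By invariance of μ, the subtracted displacements may be taken along Tω, where they become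
distances from g(ω)x₀ to orbit points of ω. The integrand is then a difference of horofunctions with
p = g(ω)x₀. -/
lemma abs_displacement_second_difference_le (hX : StronglyHyperbolic X b)
    (hT : MeasurePreserving T μ μ) {g : BddCocycle Ω b x₀} {M : ℝ} (hM : StepBound T μ M g)
    (n : ℕ) :
    |(displacement T μ g (n + 2) - displacement T μ g (n + 1)) -
        (displacement T μ g (n + 1) - displacement T μ g n)| ≤
      2 / Real.log b * b ^ M * ∫ ω, visKernel b x₀ (orbit T g (n + 1) ω) (orbit T g (n + 2) ω) ∂μ := by
  have hb := hX.one_lt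
  have hl := Real.log_pos hb
  have hTm := hT.measurable
  have i1 := integrable_dist_orbit (μ := μ) hb hTm g (n + 2)
  have i2 := integrable_dist_orbit (μ := μ) hb hTm g (n + 1)
  have i3 := integrable_dist_orbit_comp hb hT g 1 (n + 1)
  have i4 := integrable_dist_orbit_comp hb hT g 1 n
  have heq : (displacement T μ g (n + 2) - displacement T μ g (n + 1)) -
        (displacement T μ g (n + 1) - displacement T μ g n) =
      ∫ ω, ((dist (orbit T g (n + 2) ω) x₀ - dist (orbit T g (n + 1) (T^[1] ω)) x₀) -
        (dist (orbit T g (n + 1) ω) x₀ - dist (orbit T g n (T^[1] ω)) x₀)) ∂μ := by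
    have i13 : Integrable (fun ω => dist (orbit T g (n + 2) ω) x₀ -
      dist (orbit T g (n + 1) (T^[1] ω)) x₀) μ := i1.sub i3
    have i24 : Integrable (fun ω => dist (orbit T g (n + 1) ω) x₀ -
      dist (orbit T g n (T^[1] ω)) x₀) μ := i2.sub i4
    rw [integral_sub i13 i24, integral_sub i1 i3, integral_sub i2 i4,
      integral_dist_orbit_comp hb hT, integral_dist_orbit_comp hb hT]
    rfl
  rw [heq, ← integral_const_mul, ← Real.norm_eq_abs]
  refine norm_integral_le_of_norm_le
    ((integrable_visKernel_orbit hb hTm g g (n + 1) (n + 2)).const_mul _) ?_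
  filter_upwards [hM] with ω hω
  rw [Real.norm_eq_abs, ← dist_orbit_add g 1 (n + 1) ω, ← dist_orbit_add g 1 n ω,
    show 1 + (n + 1) = n + 2 by ring, show 1 + n = n + 1 by ring, dist_comm (orbit T g (n + 2) ω) x₀,
    dist_comm (orbit T g (n + 1) ω) x₀, visKernel_comm]
  refine (abs_busemann_sub_le hX x₀ (orbit T g 1 ω) _ _).trans ?_
  gcongr
  · exact (visKernel_pos hb _ _ _).le
  · exact hb.le
  · rw [orbit_one, dist_comm]
    exact hω 0

/-- The increments of the displacement vary exponentially little. -/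
lemma abs_second_difference_le_of_decay (hX : StronglyHyperbolic X b)
    (hT : MeasurePreserving T μ μ) {g : BddCocycle Ω b x₀} {M β : ℝ} (hM : StepBound T μ M g)
    (hβ0 : 0 ≤ β) (hβ1 : β ≤ 1)
    (n : ℕ) (h : ∫ ω, b ^ (-dist (orbit T g (n + 1) ω) x₀) ∂μ ≤ 2 * β ^ (n + 1)) :
    |(displacement T μ g (n + 2) - displacement T μ g (n + 1)) -
        (displacement T μ g (n + 1) - displacement T μ g n)| ≤
      4 / Real.log b * (b ^ M) ^ 2 * β ^ n := by
  have hb := hX.one_lt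
  have hl := Real.log_pos hb
  refine (abs_displacement_second_difference_le hX hT hM n).trans ?_
  have h1 := integral_visKernel_succ_le hb hT.measurable hM (n + 1)
  have h2 : β ^ (n + 1) ≤ β ^ n := pow_le_pow_of_le_one hβ0 hβ1 n.le_succ
  calc _ ≤ 2 / Real.log b * b ^ M * (b ^ M * (2 * β ^ n)) := by
        gcongr
        refine h1.trans ?_
        gcongr
        linarith
    _ = _ := by ring

end Decay

/-! ### Uniform decay near a cocycle of positive drift. -/

section Uniform

variable {X : Type*} [MetricSpace X] [TopologicalSpace.SeparableSpace X]
  {Ω : Type*} [MeasurableSpace Ω] {b : ℝ} {x₀ : X}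
  {T : Ω → Ω} {μ : Measure Ω} [IsProbabilityMeasure μ]
  {C : Set (BddCocycle Ω b x₀)} [PseudoMetricSpace C]

/-- Displacements are continuous in the cocycle. -/
lemma exists_radius_displacement (hb : 1 < b) (hT : MeasurePreserving T μ μ)
    (hdist : ∀ g₁ g₂ : C, dInfty μ g₁.1 g₂.1 ≤ dist g₁ g₂) (g : C) (n : ℕ) {ε : ℝ} (hε : 0 < ε) :
    ∃ r > 0, ∀ g₁ : C, dist g g₁ < r →
      |displacement T μ g.1 n - displacement T μ g₁.1 n| < ε := by
  obtain ⟨M, hM1, r, hr, hM⟩ := exists_uniform_stepBound hb hT g.1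
  have hl := Real.log_pos hb
  have hM0 : StepBound T μ M g.1 := by
    refine hM g.1 (lt_of_le_of_lt ?_ hr)
    simpa using hdist g g
  refine ⟨min (min r (b ^ (-(n * M)))) (ε * Real.log b / (n + 1)), by positivity,
    fun g₁ hg₁ => ?_⟩
  obtain ⟨⟨h1, h2⟩, h3⟩ : (dist g g₁ < r ∧ dist g g₁ < b ^ (-(n * M))) ∧
      dist g g₁ < ε * Real.log b / (n + 1) := by simpa only [lt_min_iff] using hg₁
  refine (abs_displacement_sub_le hb hT (by linarith) n h2 (hdist g g₁) hM0
    (hM g₁.1 ((hdist g g₁).trans_lt h1))).trans_lt ?_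
  rw [lt_div_iff₀ (by positivity)] at h3
  rw [← mul_div_assoc, div_lt_iff₀ hl]
  have : (n : ℝ) * dist g g₁ ≤ dist g g₁ * (n + 1) := by nlinarith [dist_nonneg (x := g) (y := g₁)]
  linarith

/-- Near a cocycle with positive drift, the decay estimates are uniform. -/
lemma exists_uniform_decay (hX : StronglyHyperbolic X b) (hT : MeasurePreserving T μ μ)
    (hdist : ∀ g₁ g₂ : C, dInfty μ g₁.1 g₂.1 ≤ dist g₁ g₂) (g : C) (hg : 0 < drift T μ g.1)
    (hLDE : UniformLDE T μ C g) :
    ∃ κ : ℝ, 0 < κ ∧ κ ≤ 1 ∧ ∃ M : ℝ, 1 ≤ M ∧ ∃ N : ℕ, ∃ r > 0, ∀ g₁ : C, dist g g₁ < r →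
      StepBound T μ M g₁.1 ∧ 0 < drift T μ g₁.1 ∧ ExpDecay T μ (b ^ (-κ)) N g₁.1 := by
  have hb := hX.one_lt
  have hl := Real.log_pos hb
  obtain ⟨M, hM1, r₁, hr₁, hM⟩ := exists_uniform_stepBound hb hT g.1
  obtain ⟨r₂, hr₂, c, hc, hldt⟩ := hLDE
  set l := drift T μ g.1 with hldef
  -- Half of the drift is given up so that nearby cocycles still grow at rate L.
  set L := l / 2 with hL
  have hLpos : 0 < L := by positivity
  obtain ⟨n₀, hn₀⟩ := hldt (L / 2) (by positivity)
  set s := c * (L / 2) ^ 2 with hs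
  have hspos : 0 < s := by positivity
  -- L/2 is the typical growth rate and s the large deviation exponent; the cap 1 gives κ ≤ M, as
  -- needed later.
  set κ := min (min (L / 2) s) 1 with hκ
  have hκpos : 0 < κ := by positivity
  set β := b ^ (-κ) with hβ
  have hβ0 : 0 < β := Real.rpow_pos_of_pos (by linarith) _
  have hβ1 : β < 1 := Real.rpow_lt_one_of_one_lt_of_neg hb (neg_lt_zero.2 hκpos)
  set K := 4 / Real.log b * (b ^ M) ^ 2 with hK
  have hK0 : 0 ≤ K := by positivity
  have hdecay : ∀ g₁ : C, dist g g₁ < r₂ → ∀ n ≥ n₀, n ≠ 0 → n * L ≤ displacement T μ g₁.1 n →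
      ∫ ω, b ^ (-dist (orbit T g₁.1 n ω) x₀) ∂μ ≤ 2 * β ^ n := fun g₁ hg₁ n hn hn0 hLn =>
    integral_rpow_neg_dist_orbit_le hb hT.measurable g₁.1 hn0 hLn
      ((min_le_left _ _).trans (min_le_left _ _)) ((min_le_left _ _).trans (min_le_right _ _))
      (hn₀ g₁ hg₁ n hn)
  have hsecond : ∀ g₁ : C, dist g g₁ < min r₁ r₂ → ∀ n ≥ n₀,
      ((n + 1 : ℕ) : ℝ) * L ≤ displacement T μ g₁.1 (n + 1) →
      |(displacement T μ g₁.1 (n + 2) - displacement T μ g₁.1 (n + 1)) -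
        (displacement T μ g₁.1 (n + 1) - displacement T μ g₁.1 n)| ≤ K * β ^ n :=
    fun g₁ hg₁ n hn hLn => abs_second_difference_le_of_decay hX hT
      (hM g₁.1 ((hdist g g₁).trans_lt (hg₁.trans_le (min_le_left _ _)))) hβ0.le hβ1.le n
      (hdecay g₁ (hg₁.trans_le (min_le_right _ _)) (n + 1) (by omega) n.succ_ne_zero hLn)
  obtain ⟨hlim, hge⟩ := tendsto_displacement_div hb hT g.1
  have hgrow : ∀ n : ℕ, n ≠ 0 → n * l ≤ displacement T μ g.1 n := fun n hn => by
    have := hge n hn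
    rw [le_div_iff₀ (by positivity)] at this
    linarith
  have hself : dist g g < min r₁ r₂ := by
    rw [dist_self]
    exact lt_min hr₁ hr₂
  -- For g itself the growth hypothesis is free, because a_n ≥ nl at all scales.
  have hinc : ∀ n ≥ n₀, |displacement T μ g.1 (n + 1) - displacement T μ g.1 n - l| ≤
      K * β ^ n / (1 - β) := fun n hn => by
    refine abs_increment_sub_le hβ1 (N := n₀) (fun k hk => hsecond g hself k hk ?_) hlim hn
    refine le_trans ?_ (hgrow (k + 1) k.succ_ne_zero)
    gcongr
    rw [hL]
    linarith
  have htail : Tendsto (fun n : ℕ => K * β ^ n / (1 - β)) atTop (𝓝 0) := by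
    simpa using ((tendsto_pow_atTop_nhds_zero_of_lt_one hβ0.le hβ1).const_mul K).div_const (1 - β)
  obtain ⟨N, hN1, hN2⟩ := ((htail.eventually (gt_mem_nhds (show 0 < L / 4 by positivity))).and
    (eventually_ge_atTop (n₀ + 1))).exists
  obtain ⟨r₃, hr₃, hd₃⟩ := exists_radius_displacement (T := T) hb hT hdist g N
    (show 0 < L / 4 by positivity)
  obtain ⟨r₄, hr₄, hd₄⟩ := exists_radius_displacement (T := T) hb hT hdist g (N + 1)
    (show 0 < L / 4 by positivity)
  refine ⟨κ, hκpos, min_le_right _ _, M, hM1, N, min (min r₁ r₂) (min r₃ r₄), by positivity,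
    fun g₁ hg₁ => ?_⟩
  have hg₁' := hg₁.trans_le (min_le_left _ _)
  have h3 := abs_lt.1 (hd₃ g₁ (hg₁.trans_le ((min_le_right _ _).trans (min_le_left _ _))))
  have h4 := abs_lt.1 (hd₄ g₁ (hg₁.trans_le ((min_le_right _ _).trans (min_le_right _ _))))
  have hNN : (1 : ℝ) ≤ N := by exact_mod_cast (show 1 ≤ N by omega)
  -- The increment of g at N is at least 2L - L/4, and the two perturbations cost at most L/4 each;
  -- what remains is 5L/4, which covers L plus the tail.
  have hlin : ∀ n ≥ N, n * L ≤ displacement T μ g₁.1 n := by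
    refine linear_growth_of_increments hβ1 hK0 hβ0.le ?_ ?_
      fun n hn => hsecond g₁ hg₁' n (by omega)
    · have h5 := hgrow N (by omega)
      have h6 : N * l = N * L + N * L := by rw [hL]; ring
      nlinarith
    · have h5 := (abs_le.1 (hinc N (by omega))).1
      have h6 : l = L + L := by rw [hL]; ring
      linarith
  refine ⟨hM g₁.1 ((hdist g g₁).trans_lt (hg₁'.trans_le (min_le_left _ _))), ?_, fun n hn =>
    hdecay g₁ (hg₁'.trans_le (min_le_right _ _)) n (by omega) (by omega) (hlin n hn)⟩
  refine hLpos.trans_le (ge_of_tendsto (tendsto_displacement_div hb hT g₁.1).1 ?_)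
  filter_upwards [eventually_ge_atTop N] with n hn
  have hn0 : 0 < n := by omega
  rw [le_div_iff₀ (by positivity)]
  linarith [hlin n hn]

end Uniform

/-! ### Matching the time n with the distance δ. -/

section Scales

/-- The extra 1 in the exponent M + 1 supplies a factor b^(-n), which absorbs n because n log b ≤
b^n. -/
lemma natCast_mul_le_of_le_inv_pow {b M κ δ : ℝ} (hb : 1 < b) (hκM : κ ≤ M) {n : ℕ}
    (hδ : δ ≤ (b ^ (M + 1))⁻¹ ^ n) :
    n * (δ / Real.log b) ≤ 1 / Real.log b ^ 2 * (b ^ (-κ)) ^ n := by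
  have hb0 : 0 < b := by linarith
  have hl := Real.log_pos hb
  have h1 : (b ^ (M + 1))⁻¹ ^ n = (b ^ (-M)) ^ n * (b ^ n)⁻¹ := by
    rw [← Real.rpow_neg hb0.le, neg_add, Real.rpow_add hb0, mul_pow, Real.rpow_neg_one, inv_pow]
  have h2 : (n : ℝ) * Real.log b ≤ b ^ n := by
    have := Real.add_one_le_exp ((n : ℝ) * Real.log b)
    rw [Real.exp_nat_mul, Real.exp_log hb0] at this
    linarith
  have h3 : b ^ (-M) ≤ b ^ (-κ) := Real.rpow_le_rpow_of_exponent_le hb.le (by linarith)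
  calc n * (δ / Real.log b) ≤ n * ((b ^ (-M)) ^ n * (b ^ n)⁻¹ / Real.log b) := by
        rw [← h1]
        gcongr
    _ = n * Real.log b * (b ^ n)⁻¹ * (1 / Real.log b ^ 2 * (b ^ (-M)) ^ n) := by
        field_simp
    _ ≤ 1 * (1 / Real.log b ^ 2 * (b ^ (-κ)) ^ n) := by
        gcongr
        rw [← div_eq_mul_inv]
        exact (div_le_one (by positivity)).2 h2
    _ = _ := one_mul _

lemma lt_rpow_of_le_inv_pow {b M δ : ℝ} (hb : 1 < b) {n m : ℕ} (hm : m * M < n * (M + 1))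
    (hδ : δ ≤ (b ^ (M + 1))⁻¹ ^ n) : δ < b ^ (-(m * M)) := by
  have hb0 : 0 < b := by linarith
  refine hδ.trans_lt ?_
  rw [← Real.rpow_neg hb0.le, ← Real.rpow_natCast, ← Real.rpow_mul hb0.le]
  exact Real.rpow_lt_rpow_of_exponent_lt hb (by linarith)

lemma rpow_rpow_neg_div {b M κ : ℝ} (hb : 1 < b) (hM : 0 < M + 1) :
    (b ^ (M + 1)) ^ (-(κ / (M + 1))) = b ^ (-κ) := by
  rw [← Real.rpow_mul (by linarith)]
  congr 1
  field_simp

end Scales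

/-! ### Hölder estimate for the drift. -/

section DriftHolder

variable {X : Type*} [MetricSpace X] [TopologicalSpace.SeparableSpace X]
  {Ω : Type*} [MeasurableSpace Ω] {b : ℝ} {x₀ : X}
  {T : Ω → Ω} {μ : Measure Ω} [IsProbabilityMeasure μ]

lemma abs_increment_sub_drift_le (hX : StronglyHyperbolic X b) (hT : MeasurePreserving T μ μ)
    {g : BddCocycle Ω b x₀} {M β : ℝ} {N : ℕ} (hβ0 : 0 ≤ β) (hβ1 : β < 1)
    (hM : StepBound T μ M g) (h : ExpDecay T μ β N g) {n : ℕ} (hn : N ≤ n) :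
    |displacement T μ g (n + 1) - displacement T μ g n - drift T μ g| ≤
      4 / Real.log b * (b ^ M) ^ 2 * β ^ n / (1 - β) :=
  abs_increment_sub_le hβ1 (fun k hk => abs_second_difference_le_of_decay hX hT hM hβ0 hβ1.le k
    (h (k + 1) (by omega))) (tendsto_displacement_div hX.one_lt hT g).1 hn

lemma drift_le_of_stepBound (hb : 1 < b) (hT : MeasurePreserving T μ μ)
    {g : BddCocycle Ω b x₀} {M : ℝ} (hM : StepBound T μ M g) : drift T μ g ≤ M := by
  refine ((tendsto_displacement_div hb hT g).2 1 one_ne_zero).trans ?_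
  rw [Nat.cast_one, div_one, displacement]
  calc _ ≤ ∫ _, M ∂μ := by
        refine integral_mono_ae (integrable_dist_orbit hb hT.measurable g 1)
          (integrable_const _) ?_
        filter_upwards [hM] with ω hω
        rw [orbit_one]
        exact hω 0
    _ = M := by simp

lemma abs_drift_sub_le (hX : StronglyHyperbolic X b) (hT : MeasurePreserving T μ μ)
    {κ M : ℝ} (hκ : 0 < κ) (hκ1 : κ ≤ 1) (hM1 : 1 ≤ M) (N : ℕ) :
    ∃ K, ∀ g₁ g₂ : BddCocycle Ω b x₀, ∀ δ, 0 ≤ δ → dInfty μ g₁ g₂ ≤ δ →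
      StepBound T μ M g₁ → StepBound T μ M g₂ → ExpDecay T μ (b ^ (-κ)) N g₁ →
      ExpDecay T μ (b ^ (-κ)) N g₂ →
      |drift T μ g₁ - drift T μ g₂| ≤ K * δ ^ (κ / (M + 1)) := by
  have hb := hX.one_lt
  have hl := Real.log_pos hb
  set β := b ^ (-κ) with hβ
  have hβ0 : 0 < β := Real.rpow_pos_of_pos (by linarith) _
  have hβ1 : β < 1 := Real.rpow_lt_one_of_one_lt_of_neg hb (neg_lt_zero.2 hκ)
  have hβ' : 0 < 1 - β := by linarith
  set K₁ := 4 / Real.log b * (b ^ M) ^ 2 / (1 - β) with hK₁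
  have hK₁0 : 0 ≤ K₁ := by positivity
  -- For n > M, (n+1)M < n(M+1), so the comparison of orbits is still valid at time n + 1.
  obtain ⟨N', hN'⟩ := exists_nat_gt M
  -- Each drift is within K₁β^n of its increment, and the increments differ by at most (n +
  -- (n+1))δ/log b ≤ 3nδ/log b. Both drifts lie in [0, M], whence F₀.
  refine ⟨_, fun g₁ g₂ δ hδ0 hδ h₁ h₂ k₁ k₂ => holder_of_geometric (B := b ^ (M + 1))
    (α := κ / (M + 1)) (K := 2 * K₁ + 3 * (1 / Real.log b ^ 2)) (F₀ := M)
    (Real.one_lt_rpow hb (by linarith)) (by positivity) (by positivity) (by linarith)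
    (max N N') hδ0 ?_ fun n hn hδn => ?_⟩
  · rw [abs_le]
    constructor <;> linarith [drift_nonneg hb hT g₁, drift_nonneg hb hT g₂,
      drift_le_of_stepBound hb hT h₁, drift_le_of_stepBound hb hT h₂]
  · rw [rpow_rpow_neg_div hb (by linarith), ← hβ]
    have hnN : N ≤ n := (le_max_left _ _).trans hn
    have hnM : M < n := hN'.trans_le (by exact_mod_cast (le_max_right _ _).trans hn)
    have e₁ := abs_increment_sub_drift_le hX hT hβ0.le hβ1 h₁ k₁ hnN
    have e₂ := abs_increment_sub_drift_le hX hT hβ0.le hβ1 h₂ k₂ hnN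
    have e₃ := abs_displacement_sub_le hb hT (by linarith) n
      (lt_rpow_of_le_inv_pow hb (by nlinarith) hδn) hδ h₁ h₂
    have e₄ := abs_displacement_sub_le hb hT (by linarith) (n + 1)
      (lt_rpow_of_le_inv_pow hb (by push_cast; nlinarith) hδn) hδ h₁ h₂
    have e₅ := natCast_mul_le_of_le_inv_pow hb (κ := κ) (M := M) (by linarith) hδn
    have e₆ : ((n + 1 : ℕ) : ℝ) * (δ / Real.log b) ≤ 2 * (n * (δ / Real.log b)) := by
      have : 0 ≤ δ / Real.log b := by positivity
      push_cast
      nlinarith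
    have e₇ : 4 / Real.log b * (b ^ M) ^ 2 * β ^ n / (1 - β) = K₁ * β ^ n := by
      rw [hK₁]; ring
    rw [e₇] at e₁ e₂
    rw [← hβ] at e₅
    rw [abs_le] at *
    constructor <;> nlinarith [e₁.1, e₁.2, e₂.1, e₂.2, e₃.1, e₃.2, e₄.1, e₄.2]

end DriftHolder

/-! ### Kernel tails and convergence to the boundary. -/

section Tails

variable {X : Type*} [MetricSpace X] {b : ℝ}

/-- The tails `∑_{k ≥ n} b ^ (-⟨x_k, x_{k+1}⟩_o)`. -/
noncomputable def kernelTail (b : ℝ) (o : X) (x : ℕ → X) (n : ℕ) : ENNReal :=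
  ∑' k, ENNReal.ofReal (visKernel b o (x (k + n)) (x (k + n + 1)))

/-- Chain the triangle inequality along consecutive terms. The factor 2 serves the case m = n, since
the kernel does not vanish on the diagonal of X. -/
lemma visKernel_le_kernelTail (hX : StronglyHyperbolic X b) (o : X) (x : ℕ → X) {n m : ℕ}
    (hnm : n ≤ m) : ENNReal.ofReal (visKernel b o (x m) (x n)) ≤ 2 * kernelTail b o x n := by
  have hb := hX.one_lt
  have hfar : ∀ j, ENNReal.ofReal (visKernel b o (x n) (x (j + n + 1))) ≤
      ∑ k ∈ Finset.range (j + 1), ENNReal.ofReal (visKernel b o (x (k + n)) (x (k + n + 1))) := by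
    intro j
    induction j with
    | zero => simp
    | succ j ih =>
      rw [Finset.sum_range_succ]
      refine le_trans ?_ (add_le_add_left ih _)
      rw [← ENNReal.ofReal_add (visKernel_pos hb _ _ _).le (visKernel_pos hb _ _ _).le]
      refine ENNReal.ofReal_le_ofReal ?_
      have := visKernel_triangle hX o (x n) (x (j + n + 1)) (x (j + 1 + n + 1))
      rwa [show j + 1 + n = j + n + 1 by ring] at this ⊢
  have hfar' : ∀ j, ENNReal.ofReal (visKernel b o (x n) (x (j + n + 1))) ≤ kernelTail b o x n :=
    fun j => (hfar j).trans (ENNReal.sum_le_tsum _)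
  rcases hnm.eq_or_lt with rfl | hlt
  · have h0 := hfar' 0
    rw [zero_add] at h0
    calc ENNReal.ofReal (visKernel b o (x n) (x n))
        ≤ ENNReal.ofReal (visKernel b o (x n) (x (n + 1)) + visKernel b o (x (n + 1)) (x n)) :=
          ENNReal.ofReal_le_ofReal (visKernel_triangle hX o _ _ _)
      _ ≤ _ := by
          rw [visKernel_comm b o (x (n + 1)), ← two_mul,
            ENNReal.ofReal_mul zero_le_two, ENNReal.ofReal_ofNat]
          gcongr
  · obtain ⟨j, rfl⟩ : ∃ j, m = j + n + 1 := ⟨m - n - 1, by omega⟩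
    rw [visKernel_comm]
    refine (hfar' j).trans ?_
    rw [two_mul]
    exact le_self_add

lemma visKernel_le_toReal_kernelTail (hX : StronglyHyperbolic X b) (o : X) (x : ℕ → X) {n m : ℕ}
    (hnm : n ≤ m) (hn : kernelTail b o x n ≠ ⊤) :
    visKernel b o (x m) (x n) ≤ 2 * (kernelTail b o x n).toReal := by
  have h := visKernel_le_kernelTail hX o x hnm
  rw [ENNReal.ofReal_le_iff_le_toReal (ENNReal.mul_ne_top (by simp) hn), ENNReal.toReal_mul] at h
  simpa using h

lemma tendsto_kernelTail (o : X) {x : ℕ → X} {N : ℕ} (h : kernelTail b o x N ≠ ⊤) :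
    Tendsto (kernelTail b o x) atTop (𝓝 0) := by
  have h1 := ENNReal.tendsto_sum_nat_add _ h
  refine (tendsto_add_atTop_iff_nat N).1 (h1.congr fun i => ?_)
  simp only [kernelTail, add_assoc]

lemma isGromovSeq_of_kernelTail (hX : StronglyHyperbolic X b) (o : X) {x : ℕ → X} {N : ℕ}
    (h : kernelTail b o x N ≠ ⊤) : IsGromovSeq x := by
  have hb := hX.one_lt
  rw [isGromovSeq_iff hb o]
  have h1 : Tendsto (fun p : ℕ × ℕ => 2 * kernelTail b o x (min p.1 p.2)) atTop (𝓝 0) := by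
    have hmin : Tendsto (fun p : ℕ × ℕ => min p.1 p.2) atTop atTop := by
      refine tendsto_atTop.2 fun k => ?_
      filter_upwards [eventually_ge_atTop (k, k)] with p hp
      exact le_min hp.1 hp.2
    have h2 := ENNReal.Tendsto.const_mul ((tendsto_kernelTail o h).comp hmin)
      (Or.inr (ENNReal.ofNat_ne_top (n := 2)))
    simpa using h2
  have h2 : Tendsto (fun p : ℕ × ℕ => ENNReal.ofReal (visKernel b o (x p.1) (x p.2))) atTop
      (𝓝 0) := by
    refine tendsto_of_tendsto_of_tendsto_of_le_of_le tendsto_const_nhds h1 (fun _ => zero_le)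
      fun p => ?_
    rcases le_total p.1 p.2 with hp | hp
    · simp only [min_eq_left hp]
      rw [visKernel_comm]
      exact visKernel_le_kernelTail hX o x hp
    · simp only [min_eq_right hp]
      exact visKernel_le_kernelTail hX o x hp
  have h3 := (ENNReal.tendsto_toReal ENNReal.zero_ne_top).comp h2
  rw [ENNReal.toReal_zero] at h3
  exact h3.congr fun p => ENNReal.toReal_ofReal (visKernel_pos hb _ _ _).le

lemma rho_mk_le_kernelTail (hX : StronglyHyperbolic X b) (o : X) (u : GromovSeq X) {n : ℕ}
    (h : kernelTail b o u.1 n ≠ ⊤) :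
    rho b o (.inr (GromovBoundary.mk u)) (.inl (u.1 n)) ≤ 2 * (kernelTail b o u.1 n).toReal := by
  refine rho_mk_inl_le hX o _ u ?_
  filter_upwards [eventually_ge_atTop n] with m hm
  exact visKernel_le_toReal_kernelTail hX o u.1 hm h

/-! ### Distance to a set of boundary points -/

/-- The visual distance from `ζ` to a set of boundary points. -/
noncomputable def infRho (b : ℝ) (o : X) (F : Set (GromovBoundary X)) (ζ : Bord X) : ℝ :=
  ⨅ η : F, rho b o ζ (.inr η.1)

lemma bddBelow_range_rho (hb : 1 < b) (o : X) (F : Set (GromovBoundary X)) (ζ : Bord X) :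
    BddBelow (range fun η : F => rho b o ζ (.inr η.1)) :=
  ⟨0, by rintro _ ⟨η, rfl⟩; exact rho_nonneg hb _ _ _⟩

lemma infRho_le_add (hX : StronglyHyperbolic X b) (o : X) {F : Set (GromovBoundary X)}
    (hF : F.Nonempty) (ζ ζ' : Bord X) : infRho b o F ζ ≤ rho b o ζ ζ' + infRho b o F ζ' := by
  have := hF.to_subtype
  rw [← sub_le_iff_le_add']
  refine le_ciInf fun η => ?_
  rw [sub_le_iff_le_add']
  exact (ciInf_le (bddBelow_range_rho hX.one_lt o F ζ) η).trans (hX.triangle o ζ ζ' _)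

lemma infRho_inl_le_mul (hb : 1 < b) (o : X) {F : Set (GromovBoundary X)} (hF : F.Nonempty)
    (x y : X) : infRho b o F (.inl x) ≤ b ^ dist x y * infRho b o F (.inl y) := by
  have := hF.to_subtype
  unfold infRho
  rw [Real.mul_iInf_of_nonneg (by positivity)]
  exact ciInf_mono (bddBelow_range_rho hb o F _) fun η => rho_inl_inr_le_mul hb o x y η.1

lemma continuous_infRho (hb : 1 < b) (o : X) {F : Set (GromovBoundary X)} (hF : F.Nonempty) :
    Continuous fun x : X => infRho b o F (.inl x) := by
  rw [continuous_iff_continuousAt]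
  intro y
  have hb0 : b ≠ 0 := by linarith
  have hd : Tendsto (fun x => dist x y) (𝓝 y) (𝓝 0) := by
    simpa using (continuous_id.dist continuous_const).tendsto (x := y) (f := fun x => dist x y)
  have hup : Tendsto (fun x => b ^ dist x y * infRho b o F (.inl y)) (𝓝 y)
      (𝓝 (infRho b o F (.inl y))) := by
    simpa using (((Real.continuous_const_rpow hb0).tendsto 0).comp hd).mul_const
      (infRho b o F (.inl y))
  have hlow : Tendsto (fun x => b ^ (-dist x y) * infRho b o F (.inl y)) (𝓝 y)
      (𝓝 (infRho b o F (.inl y))) := by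
    have hd' : Tendsto (fun x => -dist x y) (𝓝 y) (𝓝 0) := by simpa using hd.neg
    simpa using (((Real.continuous_const_rpow hb0).tendsto 0).comp hd').mul_const
      (infRho b o F (.inl y))
  refine tendsto_of_tendsto_of_tendsto_of_le_of_le hlow hup (fun x => ?_)
    fun x => infRho_inl_le_mul hb o hF x y
  have h := infRho_inl_le_mul hb o hF y x
  have hpos : 0 < b ^ dist x y := Real.rpow_pos_of_pos (by linarith) _
  simp only
  rw [Real.rpow_neg (by linarith), inv_mul_le_iff₀ hpos, dist_comm x y]
  exact h

/-- Exhibits a function of the boundary point as a limit of functions on X; measurability of the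
hitting point rests on this. -/
lemma tendsto_infRho (hX : StronglyHyperbolic X b) (o : X) {F : Set (GromovBoundary X)}
    (hF : F.Nonempty) (u : GromovSeq X) :
    Tendsto (fun n => infRho b o F (.inl (u.1 n))) atTop
      (𝓝 (infRho b o F (.inr (GromovBoundary.mk u)))) := by
  rw [tendsto_iff_dist_tendsto_zero]
  refine squeeze_zero (fun _ => dist_nonneg) (fun n => ?_) (tendsto_rho_mk hX o u)
  have h1 := infRho_le_add hX o hF (.inl (u.1 n)) (.inr (GromovBoundary.mk u))
  have h2 := infRho_le_add hX o hF (.inr (GromovBoundary.mk u)) (.inl (u.1 n))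
  rw [rho_inl_inr_comm] at h1
  rw [Real.dist_eq, abs_le]
  constructor <;> linarith

lemma mem_iff_infRho_pos (hX : StronglyHyperbolic X b) (o : X) {U : Set (GromovBoundary X)}
    (hU : @IsOpen _ (distTopology fun ξ η => rho b o (.inr ξ) (.inr η)) U) (hne : Uᶜ.Nonempty)
    (ξ : GromovBoundary X) : ξ ∈ U ↔ 0 < infRho b o Uᶜ (.inr ξ) := by
  have := hne.to_subtype
  constructor
  · intro h
    obtain ⟨r, hr, hball⟩ := hU ξ h
    refine hr.trans_le (le_ciInf fun η => ?_)
    by_contra hlt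
    exact η.2 (hball η.1 (not_le.1 hlt))
  · intro h
    by_contra hξ
    have h1 := ciInf_le (bddBelow_range_rho hX.one_lt o Uᶜ (.inr ξ)) ⟨ξ, hξ⟩
    rw [rho_self_boundary hX] at h1
    exact absurd h (not_lt.2 h1)

end Tails

/-! ### Hitting points: existence, measurability, Hölder estimate. -/

section Hitting

variable {X : Type*} [MetricSpace X] [TopologicalSpace.SeparableSpace X]
  {Ω : Type*} [MeasurableSpace Ω] {b : ℝ} {x₀ : X}
  {T : Ω → Ω} {μ : Measure Ω}

/-- The tails of the path `(g^{(n)}(ω) x₀)_n`. -/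
noncomputable def orbitTail (T : Ω → Ω) (g : BddCocycle Ω b x₀) (n : ℕ) (ω : Ω) : ENNReal :=
  kernelTail b x₀ (fun k => orbit T g k ω) n

lemma measurable_orbitTail (hb : 1 < b) (hT : Measurable T) (g : BddCocycle Ω b x₀) (n : ℕ) :
    Measurable (orbitTail T g n) := by
  let := borel X
  have : BorelSpace X := ⟨rfl⟩
  exact Measurable.tsum fun k => (measurable_visKernel_orbit hb hT g g _ _).ennreal_ofReal

lemma lintegral_orbitTail_le [IsProbabilityMeasure μ] (hb : 1 < b) (hT : Measurable T)
    {g : BddCocycle Ω b x₀} {M β : ℝ} {N : ℕ} (hβ0 : 0 ≤ β) (hβ1 : β < 1)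
    (hM : StepBound T μ M g) (h : ExpDecay T μ β N g) {n : ℕ} (hn : N ≤ n) :
    ∫⁻ ω, orbitTail T g n ω ∂μ ≤ ENNReal.ofReal (2 * b ^ M / (1 - β) * β ^ n) := by
  let := borel X
  have : BorelSpace X := ⟨rfl⟩
  unfold orbitTail kernelTail
  rw [lintegral_tsum fun k =>
    (measurable_visKernel_orbit hb hT g g _ _).ennreal_ofReal.aemeasurable]
  have hterm : ∀ k, ∫⁻ ω, ENNReal.ofReal
      (visKernel b x₀ (orbit T g (k + n) ω) (orbit T g (k + n + 1) ω)) ∂μ ≤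
      ENNReal.ofReal (2 * b ^ M * β ^ n * β ^ k) := fun k => by
    rw [← ofReal_integral_eq_lintegral_ofReal (integrable_visKernel_orbit hb hT g g _ _)
      (Eventually.of_forall fun ω => (visKernel_pos hb _ _ _).le)]
    refine ENNReal.ofReal_le_ofReal ((integral_visKernel_succ_le hb hT hM (k + n)).trans ?_)
    calc _ ≤ b ^ M * (2 * β ^ (k + n)) := by
          gcongr
          exact h (k + n) (by omega)
      _ = _ := by ring
  have hsum : HasSum (fun k : ℕ => 2 * b ^ M * β ^ n * β ^ k) (2 * b ^ M * β ^ n * (1 - β)⁻¹) :=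
    (hasSum_geometric_of_lt_one hβ0 hβ1).mul_left _
  refine (ENNReal.tsum_le_tsum hterm).trans_eq ?_
  rw [← ENNReal.ofReal_tsum_of_nonneg (fun k => by positivity) hsum.summable, hsum.tsum_eq]
  congr 1
  ring

lemma ae_orbitTail_ne_top [IsProbabilityMeasure μ] (hb : 1 < b) (hT : Measurable T)
    {g : BddCocycle Ω b x₀} {M β : ℝ} {N : ℕ} (hβ0 : 0 ≤ β) (hβ1 : β < 1)
    (hM : StepBound T μ M g) (h : ExpDecay T μ β N g) {n : ℕ} (hn : N ≤ n) :
    ∀ᵐ ω ∂μ, orbitTail T g n ω ≠ ⊤ :=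
  (ae_lt_top (measurable_orbitTail hb hT g n)
    ((lintegral_orbitTail_le hb hT hβ0 hβ1 hM h hn).trans_lt ENNReal.ofReal_lt_top).ne).mono
    fun _ hω => hω.ne

/-- Almost everywhere defined hitting points form a measurable boundary map. -/
lemma exists_hittingMap [IsProbabilityMeasure μ] (hX : StronglyHyperbolic X b) (hT : Measurable T)
    (g : BddCocycle Ω b x₀) (N : ℕ) (h : ∀ᵐ ω ∂μ, orbitTail T g N ω ≠ ⊤) :
    ∃ ξ : BoundaryMap Ω b x₀, ∀ᵐ ω ∂μ, IsHittingPoint T g ω (ξ.toFun ω) := by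
  classical
  have hb := hX.one_lt
  let := borel X
  have : BorelSpace X := ⟨rfl⟩
  have hG : ∀ ω, orbitTail T g N ω ≠ ⊤ → IsGromovSeq fun n => orbit T g n ω :=
    fun ω hω => isGromovSeq_of_kernelTail hX x₀ hω
  obtain ⟨ω₀, hω₀⟩ := h.exists
  set ξ₀ : GromovBoundary X := GromovBoundary.mk ⟨_, hG ω₀ hω₀⟩ with hξ₀
  set f : Ω → GromovBoundary X := fun ω =>
    if hω : orbitTail T g N ω ≠ ⊤ then GromovBoundary.mk ⟨_, hG ω hω⟩ else ξ₀ with hf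
  set E : Set Ω := {ω | orbitTail T g N ω ≠ ⊤} with hE
  have hEm : MeasurableSet E :=
    (measurable_orbitTail hb hT g N (measurableSet_singleton ⊤)).compl
  have hfE : ∀ ω (hω : ω ∈ E), f ω = GromovBoundary.mk ⟨_, hG ω hω⟩ := fun ω hω => dif_pos hω
  have hfE' : ∀ ω, ω ∉ E → f ω = ξ₀ := fun ω hω => dif_neg hω
  refine ⟨⟨f, ?_⟩, h.mono fun ω hω => ⟨hG ω hω, (hfE ω hω).symm⟩⟩
  refine @measurable_generateFrom _ _ _ {U | @IsOpen _ (distTopology fun ξ η =>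
    rho b x₀ (.inr ξ) (.inr η)) U} f fun U hU => ?_
  -- If U is everything, there is no complement to measure the distance to.
  rcases Uᶜ.eq_empty_or_nonempty with hUe | hne
  · rw [compl_empty_iff.1 hUe, preimage_univ]
    exact MeasurableSet.univ
  -- On E, membership of f(ω) in U is positivity of H; the indicator makes the approximations
  -- converge at every ω.
  set H : Ω → ℝ := E.indicator fun ω => infRho b x₀ Uᶜ (.inr (f ω)) with hH
  have hHm : Measurable H := by
    refine measurable_of_tendsto_metrizable
      (f := fun n => E.indicator fun ω => infRho b x₀ Uᶜ (.inl (orbit T g n ω)))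
      (fun n => ((continuous_infRho hb x₀ hne).measurable.comp
        (measurable_orbit hb hT g n)).indicator hEm) ?_
    rw [tendsto_pi_nhds]
    intro ω
    by_cases hω : ω ∈ E
    · simp only [hH, indicator_of_mem hω, hfE ω hω]
      exact tendsto_infRho hX x₀ hne ⟨_, hG ω hω⟩
    · simp only [hH, indicator_of_notMem hω]
      exact tendsto_const_nhds
  have hpre : f ⁻¹' U = {ω | 0 < H ω} ∪ (Eᶜ ∩ {_ω | ξ₀ ∈ U}) := by
    ext ω
    by_cases hω : ω ∈ E
    · simp [hH, hω, mem_iff_infRho_pos hX x₀ hU hne (f ω)]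
    · simp [hH, hω, hfE' ω hω]
  rw [hpre]
  exact (measurableSet_lt measurable_const hHm).union (hEm.compl.inter (MeasurableSet.const _))

omit [TopologicalSpace.SeparableSpace X] in
lemma rho_hittingPoint_le (hX : StronglyHyperbolic X b) {g : BddCocycle Ω b x₀} {ω : Ω}
    {ξ : GromovBoundary X} (hξ : IsHittingPoint T g ω ξ) {n : ℕ} (h : orbitTail T g n ω ≠ ⊤) :
    rho b x₀ (.inr ξ) (.inl (orbit T g n ω)) ≤ 2 * (orbitTail T g n ω).toReal := by
  obtain ⟨hG, rfl⟩ := hξ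
  exact rho_mk_le_kernelTail hX x₀ ⟨_, hG⟩ h

lemma integral_toReal_orbitTail_le [IsProbabilityMeasure μ] (hb : 1 < b) (hT : Measurable T)
    {g : BddCocycle Ω b x₀} {M β : ℝ} {N : ℕ} (hβ0 : 0 ≤ β) (hβ1 : β < 1)
    (hM : StepBound T μ M g) (h : ExpDecay T μ β N g) {n : ℕ} (hn : N ≤ n) :
    Integrable (fun ω => (orbitTail T g n ω).toReal) μ ∧
      ∫ ω, (orbitTail T g n ω).toReal ∂μ ≤ 2 * b ^ M / (1 - β) * β ^ n := by
  have hle := lintegral_orbitTail_le hb hT hβ0 hβ1 hM h hn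
  have hm := (measurable_orbitTail hb hT g n).aemeasurable (μ := μ)
  refine ⟨integrable_toReal_of_lintegral_ne_top hm (hle.trans_lt ENNReal.ofReal_lt_top).ne, ?_⟩
  rw [integral_toReal hm ((ae_orbitTail_ne_top hb hT hβ0 hβ1 hM h hn).mono
    fun _ hω => hω.lt_top)]
  have : 0 < 1 - β := by linarith
  exact ENNReal.toReal_le_of_le_ofReal (by positivity) hle

lemma d1_le [IsProbabilityMeasure μ] (hX : StronglyHyperbolic X b) (hT : MeasurePreserving T μ μ)
    {κ M : ℝ} (hκ : 0 < κ) (hκ1 : κ ≤ 1) (hM1 : 1 ≤ M) (N : ℕ) :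
    ∃ K, ∀ g₁ g₂ : BddCocycle Ω b x₀, ∀ ξ₁ ξ₂ : BoundaryMap Ω b x₀,
      (∀ᵐ ω ∂μ, IsHittingPoint T g₁ ω (ξ₁.toFun ω)) →
      (∀ᵐ ω ∂μ, IsHittingPoint T g₂ ω (ξ₂.toFun ω)) →
      ∀ δ, 0 ≤ δ → dInfty μ g₁ g₂ ≤ δ →
      StepBound T μ M g₁ → StepBound T μ M g₂ → ExpDecay T μ (b ^ (-κ)) N g₁ →
      ExpDecay T μ (b ^ (-κ)) N g₂ →
      d1 μ ξ₁ ξ₂ ≤ K * δ ^ (κ / (M + 1)) := by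
  have hb := hX.one_lt
  have hl := Real.log_pos hb
  set β := b ^ (-κ) with hβ
  have hβ0 : 0 < β := Real.rpow_pos_of_pos (by linarith) _
  have hβ1 : β < 1 := Real.rpow_lt_one_of_one_lt_of_neg hb (neg_lt_zero.2 hκ)
  have hβ' : 0 < 1 - β := by linarith
  -- Bounds b^d for the distance d between the two orbits at time n, in the admissible range of δ.
  set A := b ^ (1 / Real.log b ^ 2) with hA
  set K₁ := 2 * b ^ M / (1 - β) with hK₁
  have hK₁0 : 0 ≤ K₁ := by positivity
  have hA0 : 0 ≤ A := by positivity
  refine ⟨_, fun g₁ g₂ ξ₁ ξ₂ hξ₁ hξ₂ δ hδ0 hδ h₁ h₂ k₁ k₂ => holder_of_geometric (B := b ^ (M + 1))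
    (α := κ / (M + 1)) (K := 4 * K₁ + 2 * A) (F₀ := 1)
    (Real.one_lt_rpow hb (by linarith)) (by positivity) (by positivity) zero_le_one
    (max N 1) hδ0 ?_ fun n hn hδn => ?_⟩
  · have := integral_mono_of_nonneg (μ := μ) (g := fun _ => (1 : ℝ))
      (Eventually.of_forall fun ω =>
        rho_nonneg hb x₀ (.inr (ξ₁.toFun ω)) (.inr (ξ₂.toFun ω))) (integrable_const _)
      (Eventually.of_forall fun ω => rho_le_one hb x₀ (.inr (ξ₁.toFun ω)) (.inr (ξ₂.toFun ω)))
    simpa [d1] using this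
  · rw [rpow_rpow_neg_div hb (by linarith), ← hβ]
    have hnN : N ≤ n := (le_max_left _ _).trans hn
    have hn1 : (1 : ℝ) ≤ n := by exact_mod_cast (le_max_right _ _).trans hn
    obtain ⟨i₁, e₁⟩ := integral_toReal_orbitTail_le hb hT.measurable hβ0.le hβ1 h₁ k₁ hnN
    obtain ⟨i₂, e₂⟩ := integral_toReal_orbitTail_le hb hT.measurable hβ0.le hβ1 h₂ k₂ hnN
    have i₃ := integrable_rpow_neg_dist_orbit (μ := μ) hb hT.measurable g₁ n
    have e₃ : ∫ ω, b ^ (-dist (orbit T g₁ n ω) x₀) ∂μ ≤ 2 * β ^ n := k₁ n hnN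
    have hscale : n * (δ / Real.log b) ≤ 1 / Real.log b ^ 2 := by
      refine (natCast_mul_le_of_le_inv_pow hb (κ := κ) (M := M) (by linarith) hδn).trans ?_
      exact mul_le_of_le_one_right (by positivity) (pow_le_one₀ hβ0.le hβ1.le)
    -- Triangle inequality from ξ₁ to ξ₂ through the two orbit points at time n. The middle term is
    -- small because these points are close together and typically far from x₀.
    have hpt : ∀ᵐ ω ∂μ, rho b x₀ (.inr (ξ₁.toFun ω)) (.inr (ξ₂.toFun ω)) ≤
        2 * (orbitTail T g₁ n ω).toReal + A * b ^ (-dist (orbit T g₁ n ω) x₀) +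
          2 * (orbitTail T g₂ n ω).toReal := by
      filter_upwards [hξ₁, hξ₂, ae_orbitTail_ne_top hb hT.measurable hβ0.le hβ1 h₁ k₁ hnN,
        ae_orbitTail_ne_top hb hT.measurable hβ0.le hβ1 h₂ k₂ hnN,
        ae_dist_orbit_orbit_le hb hT (by linarith) n
          (lt_rpow_of_le_inv_pow hb (by nlinarith) hδn) hδ h₁ h₂] with ω a₁ a₂ t₁ t₂ hd
      have r₁ := rho_hittingPoint_le hX a₁ t₁
      have r₂ := rho_hittingPoint_le hX a₂ t₂
      rw [← rho_inl_inr_comm] at r₂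
      have r₃ : rho b x₀ (.inl (orbit T g₁ n ω)) (.inl (orbit T g₂ n ω)) ≤
          A * b ^ (-dist (orbit T g₁ n ω) x₀) := by
        rw [rho_inl_inl]
        refine (visKernel_le_mul hb _ _ _).trans ?_
        gcongr
        rw [hA]
        exact Real.rpow_le_rpow_of_exponent_le hb.le (hd.trans hscale)
      linarith [hX.triangle x₀ (.inr (ξ₁.toFun ω)) (.inl (orbit T g₁ n ω)) (.inr (ξ₂.toFun ω)),
        hX.triangle x₀ (.inl (orbit T g₁ n ω)) (.inl (orbit T g₂ n ω)) (.inr (ξ₂.toFun ω))]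
    have i₁₃ : Integrable (fun ω => 2 * (orbitTail T g₁ n ω).toReal +
        A * b ^ (-dist (orbit T g₁ n ω) x₀)) μ := (i₁.const_mul 2).add (i₃.const_mul A)
    calc d1 μ ξ₁ ξ₂ ≤ ∫ ω, (2 * (orbitTail T g₁ n ω).toReal +
          A * b ^ (-dist (orbit T g₁ n ω) x₀) + 2 * (orbitTail T g₂ n ω).toReal) ∂μ :=
          integral_mono_of_nonneg (Eventually.of_forall fun ω => rho_nonneg hb _ _ _)
            (i₁₃.add (i₂.const_mul 2)) hpt
      _ = 2 * ∫ ω, (orbitTail T g₁ n ω).toReal ∂μ +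
          A * ∫ ω, b ^ (-dist (orbit T g₁ n ω) x₀) ∂μ +
          2 * ∫ ω, (orbitTail T g₂ n ω).toReal ∂μ := by
          rw [integral_add i₁₃ (i₂.const_mul 2), integral_add (i₁.const_mul 2) (i₃.const_mul A),
            integral_const_mul, integral_const_mul, integral_const_mul]
      _ ≤ 2 * (K₁ * β ^ n) + A * (2 * β ^ n) + 2 * (K₁ * β ^ n) := by gcongr
      _ = _ := by ring

end Hitting

/-! ### Continuity of the drift and conclusion. -/

section Continuity

variable {X : Type*} [MetricSpace X] [TopologicalSpace.SeparableSpace X]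
  {Ω : Type*} [MeasurableSpace Ω] {b : ℝ} {x₀ : X}
  {T : Ω → Ω} {μ : Measure Ω} [IsProbabilityMeasure μ]
  {C : Set (BddCocycle Ω b x₀)} [PseudoMetricSpace C]

lemma exists_drift_holder (hX : StronglyHyperbolic X b) (hT : MeasurePreserving T μ μ)
    (hdist : ∀ g₁ g₂ : C, dInfty μ g₁.1 g₂.1 ≤ dist g₁ g₂) (g : C) (hg : 0 < drift T μ g.1)
    (hLDE : UniformLDE T μ C g) :
    ∃ r > 0, ∃ α : ℝ, 0 < α ∧ α ≤ 1 ∧ ∃ K : ℝ, ∀ g₁ ∈ Metric.ball g r, ∀ g₂ ∈ Metric.ball g r,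
      |drift T μ g₁.1 - drift T μ g₂.1| ≤ K * dist g₁ g₂ ^ α := by
  obtain ⟨κ, hκ, hκ1, M, hM1, N, r, hr, h⟩ := exists_uniform_decay hX hT hdist g hg hLDE
  obtain ⟨K, hK⟩ := abs_drift_sub_le (x₀ := x₀) hX hT hκ hκ1 hM1 N
  refine ⟨r, hr, κ / (M + 1), by positivity, (div_le_one (by linarith)).2 (by linarith), K,
    fun g₁ h₁ g₂ h₂ => ?_⟩
  obtain ⟨s₁, -, k₁⟩ := h g₁ (Metric.mem_ball'.1 h₁)
  obtain ⟨s₂, -, k₂⟩ := h g₂ (Metric.mem_ball'.1 h₂)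
  exact hK g₁ g₂ _ dist_nonneg (hdist g₁ g₂) s₁ s₂ k₁ k₂

/-- The drift is upper semicontinuous. -/
lemma exists_radius_drift_lt (hb : 1 < b) (hT : MeasurePreserving T μ μ)
    (hdist : ∀ g₁ g₂ : C, dInfty μ g₁.1 g₂.1 ≤ dist g₁ g₂) (g : C) {ε : ℝ} (hε : 0 < ε) :
    ∃ r > 0, ∀ g₁ : C, dist g g₁ < r → drift T μ g₁.1 < drift T μ g.1 + ε := by
  -- The drift is the infimum of the finite scale drifts, each continuous in the cocycle; one scale
  -- n close to it for g is enough.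
  obtain ⟨n, hn, hn0⟩ := (((tendsto_displacement_div hb hT g.1).1.eventually
    (gt_mem_nhds (show drift T μ g.1 < drift T μ g.1 + ε / 2 by linarith))).and
    (eventually_ge_atTop 1)).exists
  obtain ⟨r, hr, hd⟩ := exists_radius_displacement (T := T) hb hT hdist g n (half_pos hε)
  refine ⟨r, hr, fun g₁ hg₁ => ?_⟩
  have hn1 : (1 : ℝ) ≤ n := by exact_mod_cast hn0
  have h1 := (tendsto_displacement_div hb hT g₁.1).2 n (by omega)
  have h2 := (abs_lt.1 (hd g₁ hg₁)).1
  refine h1.trans_lt ?_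
  rw [div_lt_iff₀ (by linarith)] at hn ⊢
  nlinarith

theorem continuous_drift (hX : StronglyHyperbolic X b) (hT : MeasurePreserving T μ μ)
    (hdist : ∀ g₁ g₂ : C, dInfty μ g₁.1 g₂.1 ≤ dist g₁ g₂)
    (hLDE : ∀ g : C, 0 < drift T μ g.1 → UniformLDE T μ C g) :
    Continuous fun g : C => drift T μ g.1 := by
  rw [continuous_iff_continuousAt]
  intro g
  rcases (drift_nonneg hX.one_lt hT g.1).eq_or_lt with h0 | hpos
  · rw [ContinuousAt, Metric.tendsto_nhds_nhds]
    intro ε hε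
    obtain ⟨r, hr, h⟩ := exists_radius_drift_lt hX.one_lt hT hdist g hε
    refine ⟨r, hr, fun {g₁} hg₁ => ?_⟩
    have h1 := h g₁ (by rwa [dist_comm])
    rw [← h0, zero_add] at h1
    rwa [← h0, Real.dist_eq, sub_zero, abs_of_nonneg (drift_nonneg hX.one_lt hT g₁.1)]
  · obtain ⟨r, hr, α, hα, -, K, hK⟩ := exists_drift_holder hX hT hdist g hpos (hLDE g hpos)
    rw [ContinuousAt, tendsto_iff_dist_tendsto_zero]
    have h1 : Tendsto (fun g₁ : C => K * dist g₁ g ^ α) (𝓝 g) (𝓝 0) := by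
      have h2 : Tendsto (fun g₁ : C => dist g₁ g) (𝓝 g) (𝓝 0) := by
        simpa using (continuous_id.dist continuous_const).tendsto (x := g)
          (f := fun g₁ : C => dist g₁ g)
      simpa [Real.zero_rpow hα.ne'] using (h2.rpow_const (Or.inr hα.le)).const_mul K
    refine squeeze_zero' (Eventually.of_forall fun _ => dist_nonneg) ?_ h1
    filter_upwards [Metric.ball_mem_nhds g hr] with g₁ hg₁
    exact hK g₁ hg₁ g (Metric.mem_ball_self hr)

end Continuity

end StrongHyp

theorem theorem1p5
    {X : Type*} [MetricSpace X] [TopologicalSpace.SeparableSpace X] (hgeo : IsGeodesic X)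
    (b : ℝ) (hX : StronglyHyperbolic X b) (x₀ : X)
    {Ω : Type*} [MeasurableSpace Ω] (μ : Measure Ω) [IsProbabilityMeasure μ]
    (T : Ω → Ω) (hT : Ergodic T μ)
    (C : Set (BddCocycle Ω b x₀)) [PseudoMetricSpace C]
    (hdist : ∀ g₁ g₂ : C, dInfty μ g₁.1 g₂.1 ≤ dist g₁ g₂)
    (hLDE : ∀ g : C, 0 < drift T μ g.1 → UniformLDE T μ C g) :
    Continuous (fun g : C => drift T μ g.1) ∧
    LocallyHolder (fun s t : ℝ => |s - t|) (fun g : PosDrift T μ C => drift T μ g.1.1) ∧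
    ∃ ξ : PosDrift T μ C → BoundaryMap Ω b x₀,
      (∀ g : PosDrift T μ C, ∀ᵐ ω ∂μ, IsHittingPoint T g.1.1 ω ((ξ g).toFun ω)) ∧
      LocallyHolder (d1 μ) ξ := by
  have hb := hX.one_lt
  have hTm := hT.toMeasurePreserving
  refine ⟨continuous_drift hX hTm hdist hLDE, fun g => ?_, ?_⟩
  · obtain ⟨r, hr, α, hα, hα1, K, hK⟩ := exists_drift_holder hX hTm hdist g.1 g.2 (hLDE g.1 g.2)
    exact ⟨r, hr, α, hα, hα1, K, fun g₁ h₁ g₂ h₂ => hK g₁.1 h₁ g₂.1 h₂⟩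
  have hex : ∀ g : PosDrift T μ C, ∃ ξ : BoundaryMap Ω b x₀,
      ∀ᵐ ω ∂μ, IsHittingPoint T g.1.1 ω (ξ.toFun ω) := fun g => by
    obtain ⟨κ, hκ, -, M, -, N, r, hr, h⟩ :=
      exists_uniform_decay hX hTm hdist g.1 g.2 (hLDE g.1 g.2)
    obtain ⟨s, -, k⟩ := h g.1 (by rwa [dist_self])
    exact exists_hittingMap hX hTm.measurable g.1.1 N (ae_orbitTail_ne_top hb hTm.measurable
      (Real.rpow_pos_of_pos (by linarith) _).le
      (Real.rpow_lt_one_of_one_lt_of_neg hb (neg_lt_zero.2 hκ)) s k le_rfl)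
  -- Any choice works: `d1_le` uses only that the maps give hitting points almost everywhere.
  choose ξ hξ using hex
  refine ⟨ξ, hξ, fun g => ?_⟩
  obtain ⟨κ, hκ, hκ1, M, hM1, N, r, hr, h⟩ :=
    exists_uniform_decay hX hTm hdist g.1 g.2 (hLDE g.1 g.2)
  obtain ⟨K, hK⟩ := d1_le (x₀ := x₀) hX hTm hκ hκ1 hM1 N
  refine ⟨r, hr, κ / (M + 1), by positivity, (div_le_one (by linarith)).2 (by linarith), K,
    fun g₁ h₁ g₂ h₂ => ?_⟩
  obtain ⟨s₁, -, k₁⟩ := h g₁.1 (Metric.mem_ball'.1 h₁)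
  obtain ⟨s₂, -, k₂⟩ := h g₂.1 (Metric.mem_ball'.1 h₂)
  exact hK _ _ _ _ (hξ g₁) (hξ g₂) _ dist_nonneg (hdist g₁.1 g₂.1) s₁ s₂ k₁ k₂
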